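/- **Setting.** Let $K$ be a field with $\operatorname{char}K\neq 2$, let $Q$ be a locally finite quiver, and let $\rho$ be a set of paths in $Q$ of length at least $2$ such that for each vertex $v$ of $Q$ there is $N\ge 0$ such that the two-sided ideal $\langle\rho\rangle$ of the path algebra $KQ$ contains all paths of length exceeding $N$ with source or target $v$. Let $T$ be a tree, i.e. a finite quiver whose underlying undirected graph is a tree, and let $F:T\to Q$ be a quiver morphism such that $F(p)\notin\langle\rho\rangle$ for every path $p$ of $T$. The *generalised tree module* $M=F_\lambda(V_T)$ is the bound representation of $(Q,\rho)$ (equivalently, module over $KQ/\langle\rho\rangle$) with $M_i=\bigoplus_{n\in F^{-1}(i)}Kv_n$ for each vertex $i$ of $Q$, where each arrow $\gamma:i\to i'$ of $Q$ acts by $\gamma\cdot v_n=\sum v_{n'}$, the sum being over all arrows $a:n\to n'$ of $T$ with $F(a)=\gamma$. **Networks.** A *network* is a quiver together with a simple undirected graph on the same vertex set; its arrows (in either direction) and edges are called *links*; a subnetwork consists of a set of vertices and sets of arrows and edges with endpoints in it, and is connected if its underlying undirected graph is. Let $\mathcal N[1]$ be the network with vertices the pairs $(n,m)$ of vertices of $T$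 with $F(n)=F(m)$; with an arrow $(a,b):(n,m)\to(n',m')$ for all arrows $a:n\to n'$ and $b:m\to m'$ of $T$ with $F(a)=F(b)$; and with the edges $\{(n,m),(n',m)\}$ whenever $n\neq n'$ and there are arrows $n\xleftarrow{a}n''\xrightarrow{b}n'$ in $T$ with $F(a)=F(b)$, and $\{(n,m),(n,m')\}$ whenever $m\neq m'$ and there are arrows $m\xrightarrow{c}m''\xleftarrow{d}m'$ in $T$ with $F(c)=F(d)$. Let $\mathcal N[2]$ be the network with vertices $(n,m,j)$, $j\in\{-1,1\}$, arrows $(a,b,j):(n,m,j)\to(n',m',j)$ for the arrows $(a,b)$ of $\mathcal N[1]$, and edges $\{(n,m,j),(n',m',-j)\}$ for the edges $\{(n,m),(n',m')\}$ of $\mathcal N[1]$. A subnetwork $\mathcal M$ of $\mathcal N[2]$ is *complete* if for each vertex $(n,m,j)$ of $\mathcal M$: - for every arrow $a:n'\to n$ of $T$, either $\mathcal M$ contains an arrow $(a,b,j)$ with target $(n,m,j)$, or there is an arrow $c:n'\to n''$ of $T$ with $F(c)=F(a)$ such that $\mathcal M$ contains the edge $\{(n,m,j),(n'',m,-j)\}$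 (or both); - for every arrow $b:m\to m'$ of $T$, either $\mathcal M$ contains an arrow $(a,b,j)$ with source $(n,m,j)$, or there is an arrow $d:m''\to m'$ of $T$ with $F(d)=F(b)$ such that $\mathcal M$ contains the edge $\{(n,m,j),(n,m'',-j)\}$ (or both). It is *$\mathcal R[2]$-free* if there are no vertices $x,y,z$ such that $\mathcal M$ contains a link between $x$ and $y$ and a link between $y$ and $z$, and such that the images of $x,y,z$ under $(n,m,j)\mapsto(n,m)$ are three distinct, pairwise linked vertices of $\mathcal N[1]$. It is *involution-free* if it never contains both $(n,m,1)$ and $(n,m,-1)$, and *involution-invariant* if it contains $(n,m,-j)$ whenever it contains $(n,m,j)$. A *generalised graph map* (from $M$ to $M$) is a non-empty, connected, involution-free, complete and $\mathcal R[2]$-free subnetwork of $\mathcal N[2]$. A *ghost* is a non-empty, connected, involution-invariant, complete and $\mathcal R[2]$-free subnetwork of $\mathcal N[2]$. The pair $(M,M)$ is *ghost-free* if $\mathcal N[2]$ has no ghost. **Theorem B.** Suppose that $(M,M)$ is ghost-free and that the following conditions hold: 1. for all arrows $n_1\xleftarrow{a}n\xrightarrow{b}n_2$ or $n_1\xrightarrow{a}n\xleftarrow{b}n_2$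 of $T$ with $n_1\neq n_2$ and $F(a)=F(b)$, no generalised graph map contains a vertex $(n_1,n_2,j)$ with $j\in\{-1,1\}$; 2. for all vertices $n_1\neq n_2$ of $T$, if some generalised graph map contains a vertex $(n_1,n_2,j)$ with $j\in\{-1,1\}$, then no generalised graph map contains a vertex $(n_2,n_1,j')$ with $j'\in\{-1,1\}$. Then $M$ is indecomposable. -/

import Mathlib

namespace GTM

universe u v u₁ v₁ u₂ v₂ w k

/-! ### Quivers, bound quivers and trees

Quivers, quiver morphisms and paths are Mathlib's `Quiver`, `Prefunctor` and `Quiver.Path`; the set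
of all arrows of `Q` is `Quiver.Total Q`, with source `left` and target `right`. -/

/-- The action of a quiver morphism on the set of all arrows. -/
def arr {T : Type u₁} [Quiver.{v₁} T] {Q : Type u} [Quiver.{v} Q] (F : T ⥤q Q)
    (a : Quiver.Total T) : Quiver.Total Q :=
  ⟨F.obj a.left, F.obj a.right, F.map a.hom⟩

/-- The set of all paths of a quiver (including the lazy ones). -/
abbrev AllPaths (Q : Type u) [Quiver.{v} Q] := Σ i j : Q, Quiver.Path i j

/-- The two-sided ideal of the path algebra generated by a set `ρ` of paths, as a subspace of the
vector space with basis the set of all paths: it is spanned by the products of a path, an element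
of `ρ`, and a path. -/
noncomputable def relIdeal (K : Type k) [Field K] {Q : Type u} [Quiver.{v} Q]
    (ρ : Set (AllPaths Q)) : Submodule K (AllPaths Q →₀ K) :=
  Submodule.span K {x | ∃ (h i j l : Q) (p : Quiver.Path h i) (r : Quiver.Path i j)
    (q : Quiver.Path j l), (⟨i, j, r⟩ : AllPaths Q) ∈ ρ ∧
      x = Finsupp.single (⟨h, l, (p.comp r).comp q⟩ : AllPaths Q) 1}

/-- `(Q, ρ)` is a locally bound quiver with zero relations `ρ`. -/
structure IsLocallyBound (K : Type k) [Field K] {Q : Type u} [Quiver.{v} Q]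
    (ρ : Set (AllPaths Q)) : Prop where
  finite_star : ∀ i : Q, Finite (Quiver.Star i)
  finite_costar : ∀ i : Q, Finite (Quiver.Costar i)
  two_le_length : ∀ r ∈ ρ, 2 ≤ r.2.2.length
  bounded : ∀ i : Q, ∃ n : ℕ, ∀ p : AllPaths Q, (p.1 = i ∨ p.2.1 = i) → n < p.2.2.length →
    Finsupp.single p (1 : K) ∈ relIdeal K ρ

/-- The underlying undirected graph of a quiver (ignoring loops and multiplicities). -/
def underlyingGraph (T : Type u₁) [Quiver.{v₁} T] : SimpleGraph T :=
  SimpleGraph.fromRel fun n m => Nonempty (n ⟶ m)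

/-- The underlying undirected multigraph of `T` is a tree: there are no loops, no two arrows join
the same two vertices, and the underlying simple graph is a tree. (Finiteness of `T` is a separate
assumption.) -/
structure IsTree (T : Type u₁) [Quiver.{v₁} T] : Prop where
  no_loop : ∀ n : T, IsEmpty (n ⟶ n)
  simple : ∀ n m : T, Subsingleton ((n ⟶ m) ⊕ (m ⟶ n))
  isTree : (underlyingGraph T).IsTree

/-- `F : T → (Q, ρ)` is a bound quiver morphism: no path of `T` is sent into the ideal `⟨ρ⟩`. -/
def IsBoundMorphism (K : Type k) [Field K] {T : Type u₁} [Quiver.{v₁} T] {Q : Type u}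
    [Quiver.{v} Q] (F : T ⥤q Q) (ρ : Set (AllPaths Q)) : Prop :=
  ∀ (n m : T) (p : Quiver.Path n m),
    Finsupp.single (⟨F.obj n, F.obj m, F.mapPath p⟩ : AllPaths Q) (1 : K) ∉ relIdeal K ρ

/-! ### Representations -/

/-- A `K`-representation of the quiver `Q`. -/
structure Rep (K : Type k) [Field K] (Q : Type u) [Quiver.{v} Q] where
  obj : Q → Type w
  [addCommGroup : ∀ i, AddCommGroup (obj i)]
  [module : ∀ i, Module K (obj i)]
  map : ∀ {i j : Q}, (i ⟶ j) → (obj i →ₗ[K] obj j)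

attribute [instance] Rep.addCommGroup Rep.module

namespace Rep

variable {K : Type k} [Field K] {Q : Type u} [Quiver.{v} Q]

/-- The action of a path on a representation. -/
def mapPath (M : Rep.{u, v, w, k} K Q) {i : Q} :
    ∀ {j : Q}, Quiver.Path i j → (M.obj i →ₗ[K] M.obj j)
  | _, .nil => LinearMap.id
  | _, .cons p γ => M.map γ ∘ₗ M.mapPath p

/-- A subrepresentation. -/
structure Sub (M : Rep.{u, v, w, k} K Q) where
  carrier : ∀ i, Submodule K (M.obj i)
  map_mem : ∀ {i j : Q} (γ : i ⟶ j) (x : M.obj i), x ∈ carrier i → M.map γ x ∈ carrier j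

/-- `M` is non-zero, and is not the direct sum of two non-zero subrepresentations. -/
def Indecomposable (M : Rep.{u, v, w, k} K Q) : Prop :=
  (∃ i, Nontrivial (M.obj i)) ∧
    ∀ U W : M.Sub, (∀ i, IsCompl (U.carrier i) (W.carrier i)) →
      (∀ i, U.carrier i = ⊥) ∨ (∀ i, W.carrier i = ⊥)

end Rep

/-- A bound representation of `(Q, ρ)`, i.e. a module over the zero-relation algebra `KQ/⟨ρ⟩`. -/
structure BoundRep (K : Type k) [Field K] {Q : Type u} [Quiver.{v} Q] (ρ : Set (AllPaths Q))
    extends Rep.{u, v, w, k} K Q where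
  bound : ∀ (i j : Q) (r : Quiver.Path i j), (⟨i, j, r⟩ : AllPaths Q) ∈ ρ →
    toRep.mapPath r = 0

/-- The representation `V_T` with `K` at every vertex and the identity at every arrow. -/
def constRep (K : Type k) [Field K] (T : Type u₁) [Quiver.{v₁} T] : Rep.{u₁, v₁, k, k} K T where
  obj _ := K
  map _ := LinearMap.id

open Classical in
/-- The sum of the maps `U_a` over the arrows `a` in the fibre of `γ : i ⟶ j`, as a map between the
direct sums of the spaces `U_n` over the (finite) fibres of `i` and `j`. -/
noncomputable def pushdownMap {K : Type k} [Field K] {T : Type u₁} [Quiver.{v₁} T]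
    [Fintype (Quiver.Total T)] {Q : Type u} [Quiver.{v} Q] (F : T ⥤q Q)
    (U : Rep.{u₁, v₁, w, k} K T) {i j : Q} (γ : i ⟶ j) :
    (∀ n : {n : T // F.obj n = i}, U.obj n.1) →ₗ[K] (∀ n : {n : T // F.obj n = j}, U.obj n.1) :=
  ∑ a : {a : Quiver.Total T // arr F a = ⟨i, j, γ⟩},
    LinearMap.single K (fun n : {n : T // F.obj n = j} => U.obj n.1)
        ⟨a.1.right, congrArg Quiver.Total.right a.2⟩ ∘ₗ
      U.map a.1.hom ∘ₗ
      LinearMap.proj (φ := fun n : {n : T // F.obj n = i} => U.obj n.1)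
        ⟨a.1.left, congrArg Quiver.Total.left a.2⟩

/-- The push-down `F_λ U` of a representation `U` of a finite quiver `T` along `F : T → Q`:
at `j` it is the direct sum of the `U_n` over the fibre of `j`, and `γ` acts as the sum of
the maps `U_a` over the fibre of `γ`. -/
noncomputable def pushdownRep {K : Type k} [Field K] {T : Type u₁} [Quiver.{v₁} T]
    [Fintype (Quiver.Total T)] {Q : Type u} [Quiver.{v} Q] (F : T ⥤q Q)
    (U : Rep.{u₁, v₁, w, k} K T) : Rep.{u, v, max u₁ w, k} K Q where
  obj j := ∀ n : {n : T // F.obj n = j}, U.obj n.1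
  map γ := pushdownMap F U γ

theorem exists_of_pushdownMap_ne_zero {K : Type k} [Field K] {T : Type u₁} [Quiver.{v₁} T]
    [Fintype (Quiver.Total T)] {Q : Type u} [Quiver.{v} Q] (F : T ⥤q Q)
    (U : Rep.{u₁, v₁, w, k} K T) {i j : Q} (γ : i ⟶ j)
    (y : ∀ n : {n : T // F.obj n = i}, U.obj n.1) (m : {m : T // F.obj m = j})
    (h : pushdownMap F U γ y m ≠ 0) :
    ∃ a : {a : Quiver.Total T // arr F a = ⟨i, j, γ⟩}, a.1.right = m.1 ∧
      y ⟨a.1.left, congrArg Quiver.Total.left a.2⟩ ≠ 0 := by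
  classical
  rw [pushdownMap, LinearMap.sum_apply, Finset.sum_apply] at h
  obtain ⟨a, -, ha⟩ := Finset.exists_ne_zero_of_sum_ne_zero h
  refine ⟨a, ?_, fun h0 => ha (by simp [h0])⟩
  by_contra hne
  refine ha ?_
  simp only [LinearMap.comp_apply, LinearMap.single_apply]
  exact Pi.single_eq_of_ne (fun h => hne (congrArg Subtype.val h).symm) _

theorem exists_lift_of_pushdownRep_ne_zero {K : Type k} [Field K] {T : Type u₁} [Quiver.{v₁} T]
    [Fintype (Quiver.Total T)] {Q : Type u} [Quiver.{v} Q] (F : T ⥤q Q)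
    (U : Rep.{u₁, v₁, w, k} K T) {i j : Q} (p : Quiver.Path i j) (x : (pushdownRep F U).obj i)
    (m : {m : T // F.obj m = j}) (h : (pushdownRep F U).mapPath p x m ≠ 0) :
    ∃ (n : T) (q : Quiver.Path n m.1),
      (⟨F.obj n, F.obj m.1, F.mapPath q⟩ : AllPaths Q) = ⟨i, j, p⟩ := by
  induction p with
  | nil =>
    obtain ⟨m, rfl⟩ := m
    exact ⟨m, .nil, rfl⟩
  | cons p γ ih =>
    obtain ⟨⟨⟨l, r, a⟩, hFa⟩, hm, hy⟩ := exists_of_pushdownMap_ne_zero F U γ _ m h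
    obtain ⟨n, q, hq⟩ := ih _ hy
    obtain ⟨m, hm'⟩ := m
    obtain rfl : r = m := hm
    refine ⟨n, q.cons a, ?_⟩
    cases hFa
    cases hq
    rfl

/-- The push-down of `U` along a bound quiver morphism is a bound representation. -/
noncomputable def pushdown {K : Type k} [Field K] {T : Type u₁} [Quiver.{v₁} T]
    [Fintype (Quiver.Total T)] {Q : Type u} [Quiver.{v} Q] {ρ : Set (AllPaths Q)} (F : T ⥤q Q)
    (hF : IsBoundMorphism K F ρ) (U : Rep.{u₁, v₁, w, k} K T) :
    BoundRep.{u, v, max u₁ w, k} K ρ where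
  toRep := pushdownRep F U
  bound i j r hr := by
    ext x
    funext m
    by_contra hne
    obtain ⟨n, q, hq⟩ := exists_lift_of_pushdownRep_ne_zero F U r x m hne
    refine hF _ _ q ?_
    rw [hq]
    exact Submodule.subset_span ⟨i, i, j, j, .nil, r, .nil, hr, by simp⟩

/-- The generalised tree module `F_λ(V_T)`. -/
noncomputable def genTreeModule {K : Type k} [Field K] {T : Type u₁} [Quiver.{v₁} T]
    [Fintype (Quiver.Total T)] {Q : Type u} [Quiver.{v} Q] {ρ : Set (AllPaths Q)} (F : T ⥤q Q)
    (hF : IsBoundMorphism K F ρ) : BoundRep.{u, v, max u₁ k, k} K ρ :=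
  pushdown F hF (constRep K T)

/-! ### Networks -/

/-- A network: a quiver and a simple undirected graph on the same set of vertices. -/
structure Network : Type (max (u + 1) (v + 1)) where
  V : Type u
  A : Type v
  src : A → V
  tgt : A → V
  graph : SimpleGraph V

namespace Network

/-- There is a link (an arrow, an inverse arrow or an edge) from `x` to `y`. -/
def Linked (N : Network.{u, v}) (x y : N.V) : Prop :=
  N.graph.Adj x y ∨ ∃ a : N.A, (N.src a = x ∧ N.tgt a = y) ∨ (N.src a = y ∧ N.tgt a = x)

/-- The subnetwork induced by `x, y, z` is a triangle: three vertices, pairwise linked. -/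
def IsTriangle (N : Network.{u, v}) (x y z : N.V) : Prop :=
  x ≠ y ∧ y ≠ z ∧ x ≠ z ∧ N.Linked x y ∧ N.Linked y z ∧ N.Linked x z

/-- The signed double cover of a network: arrows preserve the sign, edges change it. The signs
`{-1, 1}` are the elements of `ℤˣ`. -/
def cover (N : Network.{u, v}) : Network.{u, v} where
  V := N.V × ℤˣ
  A := N.A × ℤˣ
  src a := (N.src a.1, a.2)
  tgt a := (N.tgt a.1, a.2)
  graph :=
    { Adj := fun x y => N.graph.Adj x.1 y.1 ∧ y.2 = -x.2
      symm := ⟨fun x y h => ⟨h.1.symm, by rw [h.2, neg_neg]⟩⟩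
      loopless := ⟨fun x h => N.graph.irrefl h.1⟩ }

/-- A subnetwork: a subgraph of the undirected graph, together with a set of arrows between its
vertices. -/
structure Sub (N : Network.{u, v}) extends N.graph.Subgraph where
  arrows : Set N.A
  src_mem : ∀ a ∈ arrows, N.src a ∈ verts
  tgt_mem : ∀ a ∈ arrows, N.tgt a ∈ verts

/-- There is a link of the subnetwork `M` from `x` to `y`. -/
def Sub.Linked {N : Network.{u, v}} (M : N.Sub) (x y : N.V) : Prop :=
  M.Adj x y ∨ ∃ a ∈ M.arrows, (N.src a = x ∧ N.tgt a = y) ∨ (N.src a = y ∧ N.tgt a = x)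

/-- The underlying graph of `M` is connected and non-empty. -/
def Sub.Connected {N : Network.{u, v}} (M : N.Sub) : Prop :=
  (SimpleGraph.fromRel fun x y : M.verts => M.Linked x.1 y.1).Connected

/-- `M` contains none of the blocked traversals of the double cover `N.cover`, which are the
traversals `x -- y -- z` of length two whose projections to `N` span a triangle.
(As the projections of `x`, `y`, `z` are then distinct, any link from `x` to `y` followed by any
link from `y` to `z` is a traversal.) -/
def Sub.BlockedFree {N : Network.{u, v}} (M : N.cover.Sub) : Prop :=
  ∀ x y z : N.cover.V, M.Linked x y → M.Linked y z → ¬ N.IsTriangle x.1 y.1 z.1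

/-- `M` contains at most one of the two vertices above each vertex of `N`. -/
def Sub.InvolutionFree {N : Network.{u, v}} (M : N.cover.Sub) : Prop :=
  ∀ (x : N.V) (j : ℤˣ), (x, j) ∈ M.verts → (x, -j) ∉ M.verts

/-- `M` contains with a vertex also the other vertex in the same fibre of the projection. -/
def Sub.InvolutionInvariant {N : Network.{u, v}} (M : N.cover.Sub) : Prop :=
  ∀ (x : N.V) (j : ℤˣ), (x, j) ∈ M.verts → (x, -j) ∈ M.verts

end Network

section Pair

variable {T₁ : Type u₁} [Quiver.{v₁} T₁] {T₂ : Type u₂} [Quiver.{v₂} T₂]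
  {Q : Type u} [Quiver.{v} Q]

/-- The pullback network of a pair of quiver morphisms. -/
def pullbackNetwork (F₁ : T₁ ⥤q Q) (F₂ : T₂ ⥤q Q) : Network where
  V := {x : T₁ × T₂ // F₁.obj x.1 = F₂.obj x.2}
  A := {a : Quiver.Total T₁ × Quiver.Total T₂ // arr F₁ a.1 = arr F₂ a.2}
  src a := ⟨(a.1.1.left, a.1.2.left), congrArg Quiver.Total.left a.2⟩
  tgt a := ⟨(a.1.1.right, a.1.2.right), congrArg Quiver.Total.right a.2⟩
  graph :=
    { Adj := fun x y =>
        (x.1.2 = y.1.2 ∧ x.1.1 ≠ y.1.1 ∧ ∃ a b : Quiver.Total T₁, a.left = b.left ∧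
          a.right = x.1.1 ∧ b.right = y.1.1 ∧ arr F₁ a = arr F₁ b) ∨
        (x.1.1 = y.1.1 ∧ x.1.2 ≠ y.1.2 ∧ ∃ c d : Quiver.Total T₂, c.right = d.right ∧
          c.left = x.1.2 ∧ d.left = y.1.2 ∧ arr F₂ c = arr F₂ d)
      symm := ⟨by
        rintro x y (⟨h, hne, a, b, h1, h2, h3, h4⟩ | ⟨h, hne, a, b, h1, h2, h3, h4⟩)
        · exact Or.inl ⟨h.symm, hne.symm, b, a, h1.symm, h3, h2, h4.symm⟩
        · exact Or.inr ⟨h.symm, hne.symm, b, a, h1.symm, h3, h2, h4.symm⟩⟩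
      loopless := ⟨by
        rintro x (⟨-, hne, -⟩ | ⟨-, hne, -⟩) <;> exact hne rfl⟩ }

/-- The 2-covering network of a pair of quiver morphisms. -/
abbrev coverNetwork (F₁ : T₁ ⥤q Q) (F₂ : T₂ ⥤q Q) : Network := (pullbackNetwork F₁ F₂).cover

variable {F₁ : T₁ ⥤q Q} {F₂ : T₂ ⥤q Q}

/-- Completeness of a subnetwork of the 2-covering network. For a vertex `(n, m, j)`:
* for every arrow `a : n' ⟶ n` of the first tree, the subnetwork contains an arrow
  `(a, b, j)` ending in `(n, m, j)`, or an edge from `(n, m, j)` to some `(n'', m, -j)` where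
  `c : n' ⟶ n''` has the same image as `a`;
* for every arrow `b : m ⟶ m'` of the second tree, the subnetwork contains an arrow
  `(a, b, j)` starting in `(n, m, j)`, or an edge from `(n, m, j)` to some `(n, m'', -j)` where
  `d : m'' ⟶ m'` has the same image as `b`. -/
def IsComplete (M : (coverNetwork F₁ F₂).Sub) : Prop :=
  ∀ (x : (pullbackNetwork F₁ F₂).V) (j : ℤˣ), (x, j) ∈ M.verts →
    (∀ a : Quiver.Total T₁, a.right = x.1.1 →
      (∃ c ∈ M.arrows, c.1.1.1 = a ∧ (coverNetwork F₁ F₂).tgt c = (x, j)) ∨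
      (∃ c : Quiver.Total T₁, c.left = a.left ∧ arr F₁ a = arr F₁ c ∧
        ∃ y : (pullbackNetwork F₁ F₂).V, y.1 = (c.right, x.1.2) ∧ M.Adj (x, j) (y, -j))) ∧
    (∀ b : Quiver.Total T₂, b.left = x.1.2 →
      (∃ c ∈ M.arrows, c.1.1.2 = b ∧ (coverNetwork F₁ F₂).src c = (x, j)) ∨
      (∃ d : Quiver.Total T₂, d.right = b.right ∧ arr F₂ b = arr F₂ d ∧
        ∃ y : (pullbackNetwork F₁ F₂).V, y.1 = (x.1.1, d.left) ∧ M.Adj (x, j) (y, -j)))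

/-- A generalised graph map. (`Connected` includes being non-empty.) -/
structure IsGenGraphMap (M : (coverNetwork F₁ F₂).Sub) : Prop where
  connected : M.Connected
  involutionFree : M.InvolutionFree
  complete : IsComplete M
  blockedFree : M.BlockedFree

/-- A ghost. (`Connected` includes being non-empty.) -/
structure IsGhost (M : (coverNetwork F₁ F₂).Sub) : Prop where
  connected : M.Connected
  involutionInvariant : M.InvolutionInvariant
  complete : IsComplete M
  blockedFree : M.BlockedFree

variable (F₁ F₂) in
/-- The pair of generalised tree modules given by `F₁` and `F₂` is ghost-free. -/
def GhostFree : Prop := ∀ M : (coverNetwork F₁ F₂).Sub, ¬ IsGhost M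

variable (F₁ F₂) in
/-- Some generalised graph map contains the vertex `(n, m, j)`. -/
def InGenGraphMap (n : T₁) (m : T₂) (j : ℤˣ) : Prop :=
  ∃ G : (coverNetwork F₁ F₂).Sub, IsGenGraphMap G ∧
    ∃ h : F₁.obj n = F₂.obj m, ((⟨(n, m), h⟩, j) : (coverNetwork F₁ F₂).V) ∈ G.verts

end Pair

end GTM

/-! An endomorphism of M is a matrix A on the vertices of T, supported on pairs with equal image in
Q and subject to one linear equation with coefficients ±1 for each triple (n, γ, m). The support of
a solution is unforced: it never meets an equation in exactly one variable. In a minimal non-empty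
unforced set S, arrange the variables of each equation cyclically and match signed copies of
neighbours whose contributions cancel (`IsUnforced.exists_isMatching`). A component of the matching
is a connected, complete, R[2]-free subnetwork of the cover. By minimality it projects onto S, and
if it contains one variable with both signs it is all of S × {±1}, a ghost. Without ghosts it is a
generalised graph map, and its signs form a solution with values 0, ±1. Subtracting multiples of
such solutions shrinks supports, so the endomorphisms over any field are spanned by reductions of
integral ones supported on generalised graph maps (`mem_span_of_mem_endAlgebra`).

Condition 1 now makes the diagonal of an endomorphism constant, and condition 2 makes diagonal
entries multiplicative. Hence an idempotent A has diagonal 0 or 1, and passing to 1 - A one may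
assume 0. All positive powers of A then have trace zero, which forces nilpotency only in
characteristic zero. In general A = ∑ c_i C_i with integral C_i of zero diagonal; the trace argument
applies to the generic matrix ∑ X_i C_i over the fraction field of ℤ[X], and specialising shows that
A is nilpotent, hence zero. So 0 and 1 are the only idempotents, and M does not split. -/

namespace GTM

/-! ### Nilpotency from vanishing traces -/

section Nilpotent

open Polynomial

theorem trace_aeval_X_mul_eq_zero {R n : Type*} [CommRing R] [Fintype n] [DecidableEq n]
    (A : Matrix n n R) (h : ∀ k : ℕ, (A ^ (k + 1)).trace = 0) (p : R[X]) :
    (aeval A (X * p)).trace = 0 := by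
  induction p using Polynomial.induction_on' with
  | add p q hp hq => rw [mul_add, map_add, Matrix.trace_add, hp, hq, add_zero]
  | monomial k c =>
    rw [X_mul_monomial, aeval_monomial, Algebra.algebraMap_eq_smul_one, smul_mul_assoc, one_mul,
      Matrix.trace_smul, h, smul_zero]

/-- The trace of an idempotent is its rank, read in `k`; characteristic zero makes this faithful. -/
theorem eq_zero_of_isIdempotentElem_of_trace_eq_zero {k n : Type*} [Field k] [CharZero k]
    [Fintype n] [DecidableEq n] {e : Matrix n n k} (he : IsIdempotentElem e)
    (ht : e.trace = 0) : e = 0 := by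
  have hi : IsIdempotentElem (Matrix.toLin' e) := by
    rw [IsIdempotentElem, Module.End.mul_eq_comp, ← Matrix.toLin'_mul, he.eq]
  refine Matrix.toLin'.map_eq_zero_iff.1 (LinearMap.IsIdempotentElem.eq_zero_of_trace_eq_zero hi ?_)
  rw [Matrix.trace_toLin'_eq, ht]

/-- Over a field of characteristic zero, a matrix all of whose powers have trace zero is
nilpotent. -/
theorem isNilpotent_of_trace_pow_eq_zero {k n : Type*} [Field k] [CharZero k] [Fintype n]
    [DecidableEq n] (A : Matrix n n k) (h : ∀ k : ℕ, (A ^ (k + 1)).trace = 0) :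
    IsNilpotent A := by
  obtain ⟨q, hq, hdvd⟩ := exists_eq_pow_rootMultiplicity_mul_and_not_dvd A.charpoly
    A.charpoly_monic.ne_zero 0
  rw [map_zero, sub_zero] at hq hdvd
  set a := rootMultiplicity 0 A.charpoly
  have hA : aeval A (X ^ a * q) = 0 := by rw [← hq, Matrix.aeval_self_charpoly]
  -- The Bézout relation makes `u * X ^ (a + 1)`, evaluated at `A`, the idempotent onto the part
  -- where `A` is invertible. The exponent is `a + 1` rather than `a` so that a factor `X` is
  -- present even if `a = 0`.
  obtain ⟨u, v, huv⟩ : IsCoprime (X ^ (a + 1)) q :=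
    ((Polynomial.irreducible_X.coprime_iff_not_dvd).2 hdvd).pow_left
  have he : aeval A (u * X ^ (a + 1)) = 0 := by
    apply eq_zero_of_isIdempotentElem_of_trace_eq_zero
    · have : u * X ^ (a + 1) * (u * X ^ (a + 1)) =
          u * X ^ (a + 1) - (u * v * X) * (X ^ a * q) := by
        linear_combination u * X ^ (a + 1) * huv
      rw [IsIdempotentElem, ← map_mul, this, map_sub, map_mul _ (u * v * X), hA, mul_zero,
        sub_zero]
    · have : u * X ^ (a + 1) = X * (u * X ^ a) := by ring
      rw [this]
      exact trace_aeval_X_mul_eq_zero A h _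
  refine ⟨a + 1, ?_⟩
  have : (X ^ (a + 1) : k[X]) = X ^ (a + 1) * (u * X ^ (a + 1)) + (v * X) * (X ^ a * q) := by
    linear_combination - X ^ (a + 1) * huv
  rw [← aeval_X (R := k) A, ← map_pow, this, map_add, map_mul, he, map_mul, hA, mul_zero,
    mul_zero, add_zero]

end Nilpotent

/-! ### Short paths in forests -/

section Acyclic

variable {V : Type*} {G : SimpleGraph V}

/-- As in the next two lemmas, the configuration would give two different paths with the same ends,
which a forest does not have. -/
theorem _root_.SimpleGraph.IsAcyclic.not_adj_of_adj_adj (h : G.IsAcyclic) {x y z : V}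
    (hxy : G.Adj x y) (hyz : G.Adj y z) : ¬ G.Adj x z := by
  intro hxz
  have hp : (SimpleGraph.Walk.cons hxy (.cons hyz .nil)).IsPath := by
    simp [SimpleGraph.Walk.isPath_def, hxy.ne, hyz.ne, hxz.ne]
  have hq : (SimpleGraph.Walk.cons hxz .nil).IsPath := by
    simp [SimpleGraph.Walk.isPath_def, hxz.ne]
  simpa using congrArg (fun p => p.1.length) ((h.subsingleton_path _ _).elim ⟨_, hp⟩ ⟨_, hq⟩)

theorem _root_.SimpleGraph.IsAcyclic.eq_of_adj_adj (h : G.IsAcyclic) {x y p q : V} (hxy : x ≠ y)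
    (hxp : G.Adj x p) (hpy : G.Adj p y) (hxq : G.Adj x q) (hqy : G.Adj q y) : p = q := by
  have hp : (SimpleGraph.Walk.cons hxp (.cons hpy .nil)).IsPath := by
    simp [SimpleGraph.Walk.isPath_def, hxp.ne, hpy.ne, hxy]
  have hq : (SimpleGraph.Walk.cons hxq (.cons hqy .nil)).IsPath := by
    simp [SimpleGraph.Walk.isPath_def, hxq.ne, hqy.ne, hxy]
  simpa using congrArg (fun p => p.1.support) ((h.subsingleton_path _ _).elim ⟨_, hp⟩ ⟨_, hq⟩)

/-- Three distinct vertices of a forest which have pairwise a common neighbour have one common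
neighbour. -/
theorem _root_.SimpleGraph.IsAcyclic.eq_of_pairwise_adj_adj (h : G.IsAcyclic) {x y z p q r : V}
    (hxy : x ≠ y) (hyz : y ≠ z) (hxz : x ≠ z) (hxp : G.Adj x p) (hpy : G.Adj p y)
    (hyq : G.Adj y q) (hqz : G.Adj q z) (hxr : G.Adj x r) (hrz : G.Adj r z) : p = q := by
  by_contra hpq
  have hxq : x ≠ q := by
    rintro rfl
    exact h.not_adj_of_adj_adj hxp hpy hyq.symm
  have hpz : p ≠ z := by
    rintro rfl
    exact h.not_adj_of_adj_adj hyq hqz hpy.symm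
  have hp : (SimpleGraph.Walk.cons hxp (.cons hpy (.cons hyq (.cons hqz .nil)))).IsPath := by
    simp [SimpleGraph.Walk.isPath_def, hxp.ne, hpy.ne, hxy, hyq.ne, hqz.ne, hyz, hxz, hxq, hpz,
      hpq]
  have hq : (SimpleGraph.Walk.cons hxr (.cons hrz .nil)).IsPath := by
    simp [SimpleGraph.Walk.isPath_def, hxr.ne, hrz.ne, hxz]
  simpa using congrArg (fun p => p.1.length) ((h.subsingleton_path _ _).elim ⟨_, hp⟩ ⟨_, hq⟩)

end Acyclic

/-! ### Signed incidence systems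

A family of finite sets `mem i` of variables with signs `sg i` encodes the homogeneous linear
equations `∑ x ∈ mem i, sg i x * f x = 0`. -/

section System

variable {V ι : Type*}

/-- No equation involves exactly one variable of `S`. -/
def IsUnforced (mem : ι → Finset V) (S : Finset V) : Prop :=
  ∀ i, ∀ x ∈ S, x ∈ mem i → ∃ y ∈ S, y ∈ mem i ∧ y ≠ x

/-- `μ i` matches the signed variables `S × {±1}` which occur in the `i`-th equation, such that the
contributions of matched signed variables cancel. -/
structure IsMatching (mem : ι → Finset V) (sg : ι → V → ℤˣ) (S : Finset V)
    (μ : ι → V × ℤˣ → V × ℤˣ → Prop) : Prop where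
  symm : ∀ {i p q}, μ i p q → μ i q p
  mem_left : ∀ {i p q}, μ i p q → p.1 ∈ mem i
  mem_support : ∀ {i p q}, μ i p q → p.1 ∈ S
  ne : ∀ {i p q}, μ i p q → p.1 ≠ q.1
  sign : ∀ {i p q}, μ i p q → sg i p.1 * p.2 = -(sg i q.1 * q.2)
  unique : ∀ {i p q q'}, μ i p q → μ i p q' → q = q'
  exists_match : ∀ {i p}, p.1 ∈ mem i → p.1 ∈ S → ∃ q, μ i p q

/-- Unforcedness means that a cyclic permutation `σ i` of the variables of `S` in the `i`-th
equation has no fixed point. The copy of `x` contributing +1 is matched with the copy of `σ i x`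
contributing -1. Each signed variable contributes either +1, and is matched forwards, or -1, and is
matched backwards. -/
theorem IsUnforced.exists_isMatching {mem : ι → Finset V} {S : Finset V} (hS : IsUnforced mem S)
    (sg : ι → V → ℤˣ) : ∃ μ, IsMatching mem sg S μ := by
  classical
  choose σ hσ _ using fun i => (mem i ∩ S).countable_toSet.exists_cycleOn
  have hne : ∀ {i x}, x ∈ mem i ∩ S → σ i x ≠ x := fun {i x} hx => by
    refine (hσ i).apply_ne ?_ hx
    obtain ⟨hx, hxS⟩ := Finset.mem_inter.1 hx
    obtain ⟨y, hyS, hy, hyx⟩ := hS i x hxS hx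
    exact ⟨x, by simp [hx, hxS], y, by simp [hy, hyS], hyx.symm⟩
  have hmem : ∀ {i x}, σ i x ∈ mem i ∩ S ↔ x ∈ mem i ∩ S := fun {i x} => (hσ i).apply_mem_iff
  let ν : ι → V × ℤˣ → V × ℤˣ → Prop := fun i p q =>
    p.1 ∈ mem i ∩ S ∧ q.1 = σ i p.1 ∧ p.2 = sg i p.1 ∧ q.2 = -sg i q.1
  have hu : ∀ u : ℤˣ, u ≠ -u := by decide
  refine ⟨fun i p q => ν i p q ∨ ν i q p, ?_, ?_, ?_, ?_, ?_, ?_, ?_⟩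
  · exact fun h => h.symm
  · rintro i p q (⟨h, -⟩ | ⟨h, h', -⟩)
    · exact Finset.inter_subset_left h
    · rw [h']
      exact Finset.inter_subset_left (hmem.2 h)
  · rintro i p q (⟨h, -⟩ | ⟨h, h', -⟩)
    · exact Finset.inter_subset_right h
    · rw [h']
      exact Finset.inter_subset_right (hmem.2 h)
  · rintro i p q (⟨h, h', -⟩ | ⟨h, h', -⟩)
    · rw [h']
      exact (hne h).symm
    · rw [h']
      exact hne h
  · rintro i p q (⟨-, -, h, h'⟩ | ⟨-, -, h, h'⟩) <;> simp [h, h']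
  · rintro i p q q' (⟨h1, h2, h3, h4⟩ | ⟨h1, h2, h3, h4⟩) (⟨h5, h6, h7, h8⟩ | ⟨h5, h6, h7, h8⟩)
    · ext
      · rw [h2, h6]
      · rw [h4, h8, h2, h6]
    · exact absurd (h3.symm.trans h8) (hu _)
    · exact absurd (h7.symm.trans h4) (hu _)
    · have : q.1 = q'.1 := (σ i).injective (h2.symm.trans h6)
      ext
      · exact this
      · rw [h3, h7, this]
  · rintro i ⟨x, j⟩ hx hxS
    have hx' : x ∈ mem i ∩ S := Finset.mem_inter.2 ⟨hx, hxS⟩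
    rcases Int.units_eq_one_or (j * sg i x) with h | h
    · refine ⟨(σ i x, -sg i (σ i x)), Or.inl ⟨hx', rfl, ?_, rfl⟩⟩
      rwa [mul_eq_one_iff_eq_inv, Int.units_inv_eq_self] at h
    · refine ⟨((σ i)⁻¹ x, sg i ((σ i)⁻¹ x)), Or.inr ⟨?_, ?_, rfl, ?_⟩⟩
      · rw [← hmem]
        simpa using hx'
      · simp
      · change j = -sg i x
        rw [← neg_eq_iff_eq_neg, neg_mul_eq_neg_mul, mul_eq_one_iff_eq_inv,
          Int.units_inv_eq_self] at h
        rw [← h, neg_neg]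

namespace IsMatching

variable {mem : ι → Finset V} {sg : ι → V → ℤˣ} {S : Finset V}
  {μ : ι → V × ℤˣ → V × ℤˣ → Prop}

/-- The component of a signed variable with respect to a matching. -/
def component (μ : ι → V × ℤˣ → V × ℤˣ → Prop) (p : V × ℤˣ) : Set (V × ℤˣ) :=
  {q | Relation.ReflTransGen (fun p q => ∃ i, μ i p q) p q}

theorem mem_component_self (p : V × ℤˣ) : p ∈ component μ p := .refl

theorem mem_component_of_match {p q r : V × ℤˣ} {i : ι} (hq : q ∈ component μ p) (h : μ i q r) :
    r ∈ component μ p :=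
  hq.tail ⟨i, h⟩

theorem mem_component_trans {p q r : V × ℤˣ} (hq : q ∈ component μ p) (hr : r ∈ component μ q) :
    r ∈ component μ p :=
  Relation.ReflTransGen.trans hq hr

theorem mem_component_symm (hμ : IsMatching mem sg S μ) {p q : V × ℤˣ} (hq : q ∈ component μ p) :
    p ∈ component μ q := by
  have : Std.Symm (fun p q => ∃ i, μ i p q) := ⟨fun p q ⟨i, h⟩ => ⟨i, hμ.symm h⟩⟩
  exact Std.Symm.symm (r := Relation.ReflTransGen (fun p q => ∃ i, μ i p q)) _ _ hq

theorem mem_support_of_mem_component (hμ : IsMatching mem sg S μ) {p q : V × ℤˣ} (hp : p.1 ∈ S)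
    (hq : q ∈ component μ p) : q.1 ∈ S := by
  induction hq with
  | refl => exact hp
  | tail _ h _ =>
    obtain ⟨i, h⟩ := h
    exact hμ.mem_support (hμ.symm h)

/-- If `S` is minimal, every component projects onto `S`. -/
theorem exists_mem_component (hμ : IsMatching mem sg S μ)
    (hmin : ∀ S' ⊆ S, S'.Nonempty → IsUnforced mem S' → S' = S) {p : V × ℤˣ} (hp : p.1 ∈ S)
    {x : V} (hx : x ∈ S) : ∃ j, (x, j) ∈ component μ p := by
  classical
  -- The projection of a component is itself unforced, since the partner of a signed variable in any
  -- equation stays in the component.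
  have := hmin {x ∈ S | ∃ j, (x, j) ∈ component μ p} (Finset.filter_subset _ _)
    ⟨p.1, Finset.mem_filter.2 ⟨hp, p.2, mem_component_self p⟩⟩ ?_
  · rw [← this] at hx
    exact (Finset.mem_filter.1 hx).2
  · intro i x hx hxi
    obtain ⟨hxS, j, hj⟩ := Finset.mem_filter.1 hx
    obtain ⟨⟨y, k⟩, hy⟩ := hμ.exists_match (p := (x, j)) hxi hxS
    exact ⟨y, Finset.mem_filter.2 ⟨hμ.mem_support (hμ.symm hy), k, mem_component_of_match hj hy⟩,
      hμ.mem_left (hμ.symm hy), (hμ.ne hy).symm⟩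

/-- If `S` is minimal and a component contains a variable with both signs, it is everything. -/
theorem mem_component_of_mem_of_neg_mem (hμ : IsMatching mem sg S μ)
    (hmin : ∀ S' ⊆ S, S'.Nonempty → IsUnforced mem S' → S' = S) {p : V × ℤˣ} (hp : p.1 ∈ S)
    {x : V} {j : ℤˣ} (h : (x, j) ∈ component μ p) (h' : (x, -j) ∈ component μ p)
    {q : V × ℤˣ} (hq : q.1 ∈ S) : q ∈ component μ p := by
  -- The component of `q` also projects onto `S`, so it contains `x` with some sign and meets the
  -- component of `p`.
  obtain ⟨k, hk⟩ := hμ.exists_mem_component hmin hq (hμ.mem_support_of_mem_component hp h)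
  refine mem_component_trans ?_ (hμ.mem_component_symm hk)
  rcases Int.units_eq_one_or j with rfl | rfl <;> rcases Int.units_eq_one_or k with rfl | rfl <;>
    simp_all

open Classical in
/-- The function which is `j` at `x` for `(x, j)` in the set `C`. -/
noncomputable def signFun (C : Set (V × ℤˣ)) (x : V) : ℤ :=
  if (x, 1) ∈ C then 1 else if (x, -1) ∈ C then -1 else 0

theorem signFun_eq {C : Set (V × ℤˣ)} (hC : ∀ x j, (x, j) ∈ C → (x, -j) ∉ C) {x : V} {j : ℤˣ}
    (h : (x, j) ∈ C) : signFun C x = j := by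
  rcases Int.units_eq_one_or j with rfl | rfl
  · simp [signFun, h]
  · have := hC _ _ h
    rw [neg_neg] at this
    simp [signFun, h, this]

theorem signFun_eq_zero {C : Set (V × ℤˣ)} {x : V} (h : ¬ ∃ j, (x, j) ∈ C) : signFun C x = 0 := by
  push Not at h
  simp [signFun, h]

/-- A component which contains every variable with at most one sign solves all equations. -/
theorem sum_signFun_eq_zero (hμ : IsMatching mem sg S μ) {p : V × ℤˣ} (hp : p.1 ∈ S)
    (hC : ∀ x j, (x, j) ∈ component μ p → (x, -j) ∉ component μ p) (i : ι) :
    ∑ x ∈ mem i, (sg i x : ℤ) * signFun (component μ p) x = 0 := by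
  classical
  set C := component μ p with hCdef
  have hs : ∑ x ∈ mem i with ∃ j, (x, j) ∈ C, (sg i x : ℤ) * signFun C x =
      ∑ x ∈ mem i, (sg i x : ℤ) * signFun C x := by
    refine Finset.sum_subset (Finset.filter_subset _ _) fun x hx hx' => ?_
    rw [signFun_eq_zero fun h => hx' (Finset.mem_filter.2 ⟨hx, h⟩), mul_zero]
  rw [← hs]
  have hex : ∀ x ∈ {x ∈ mem i | ∃ j, (x, j) ∈ C}, ∃ y j k, (x, j) ∈ C ∧ μ i (x, j) (y, k) := by
    intro x hx
    obtain ⟨hx, j, hj⟩ := Finset.mem_filter.1 hx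
    obtain ⟨⟨y, k⟩, h⟩ := hμ.exists_match (p := (x, j)) hx (hμ.mem_support_of_mem_component hp hj)
    exact ⟨y, j, k, hj, h⟩
  choose y j k hj hjk using hex
  have huniq : ∀ {x j k}, (x, j) ∈ C → (x, k) ∈ C → j = k := by
    intro x j k h h'
    have := hC _ _ h
    rcases Int.units_eq_one_or j with rfl | rfl <;>
      rcases Int.units_eq_one_or k with rfl | rfl <;> simp_all
  have hyC : ∀ x hx, (y x hx, k x hx) ∈ C := fun x hx =>
    mem_component_of_match (hj x hx) (hjk x hx)
  have hymem : ∀ x hx, y x hx ∈ {x ∈ mem i | ∃ j, (x, j) ∈ C} := fun x hx =>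
    Finset.mem_filter.2 ⟨hμ.mem_left (hμ.symm (hjk x hx)), _, hyC x hx⟩
  -- Matched terms cancel in pairs. The partner of the partner is the original variable because the
  -- component fixes the sign of each of its variables.
  refine Finset.sum_involution y ?_ ?_ hymem ?_
  · intro x hx
    rw [signFun_eq hC (hj x hx), signFun_eq hC (hyC x hx)]
    have := congrArg (fun u : ℤˣ => (u : ℤ)) (hμ.sign (hjk x hx))
    simp only [Units.val_mul, Units.val_neg] at this
    rw [this, neg_add_cancel]
  · exact fun x hx _ => (hμ.ne (hjk x hx)).symm
  · intro x hx
    have h1 := hjk _ (hymem x hx)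
    rw [huniq (hj _ (hymem x hx)) (hyC x hx)] at h1
    exact congrArg Prod.fst (hμ.unique h1 (hμ.symm (hjk x hx)))

end IsMatching

/-- An equation with a single non-zero term cannot hold, because the coefficients are ±1. -/
theorem isUnforced_of_sum_eq_zero {K : Type*} [Field K] {mem : ι → Finset V} {sg : ι → V → ℤˣ}
    (f : V → K) (hf : ∀ i, ∑ x ∈ mem i, ((sg i x : ℤ) : K) * f x = 0) (S : Finset V)
    (hS : ∀ x, x ∈ S ↔ f x ≠ 0) : IsUnforced mem S := by
  intro i x hxS hx
  by_contra! h
  have := hf i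
  rw [Finset.sum_eq_single_of_mem x hx] at this
  · rcases Int.units_eq_one_or (sg i x) with h1 | h1 <;> rw [h1] at this <;>
      exact (hS x).1 hxS (by simpa using this)
  · intro y hy hyx
    have : f y = 0 := by
      by_contra h0
      exact hyx (h y ((hS y).2 h0) hy)
    rw [this, mul_zero]

/-- If every non-empty unforced set supports a solution with values `0, ±1` in the set `G`, then
these solutions span all solutions over any field. -/
theorem mem_span_of_forall_exists {K : Type*} [Field K] [Fintype V] {mem : ι → Finset V}
    {sg : ι → V → ℤˣ} (G : Set (V → ℤ))
    (hG : ∀ g ∈ G, ∀ i, ∑ x ∈ mem i, (sg i x : ℤ) * g x = 0)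
    (hex : ∀ S : Finset V, S.Nonempty → IsUnforced mem S → ∃ g ∈ G, (∀ x, g x ≠ 0 → x ∈ S) ∧
      ∃ x ∈ S, IsUnit (g x))
    (f : V → K) (hf : ∀ i, ∑ x ∈ mem i, ((sg i x : ℤ) : K) * f x = 0) :
    f ∈ Submodule.span K ((fun (g : V → ℤ) x => (g x : K)) '' G) := by
  classical
  induction hn : ({x | f x ≠ 0} : Finset V).card using Nat.strong_induction_on generalizing f with
  | _ n ih =>
    rcases Finset.eq_empty_or_nonempty ({x | f x ≠ 0} : Finset V) with h0 | h0
    · have : f = 0 := by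
        ext x
        by_contra hx
        simpa [h0] using (Finset.mem_filter.2 ⟨Finset.mem_univ x, hx⟩ : x ∈ ({x | f x ≠ 0} : Finset V))
      rw [this]
      exact zero_mem _
    · obtain ⟨g, hg, hgS, x, hxS, hx⟩ := hex _ h0 (isUnforced_of_sum_eq_zero f hf _ (by simp))
      -- As `g x` is a unit of ℤ, it stays non-zero in every characteristic; subtracting a multiple
      -- of `g` then removes `x` from the support of `f` without enlarging it.
      have hxK : (g x : K) ≠ 0 := (hx.map (Int.castRingHom K)).ne_zero
      set g' : V → K := fun x => (g x : K) with hg'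
      have hsub : f = (f - (f x / g x) • g') + (f x / g x) • g' := by abel
      rw [hsub]
      refine add_mem (ih _ ?_ _ ?_ rfl)
        (Submodule.smul_mem _ _ (Submodule.subset_span ⟨g, hg, rfl⟩))
      · rw [← hn]
        refine Finset.card_lt_card ((Finset.ssubset_iff_of_subset ?_).2 ⟨x, hxS, ?_⟩)
        · intro y hy
          by_contra hyf
          have hgy : g y = 0 := by
            by_contra h
            exact hyf (hgS y h)
          simp only [Finset.mem_filter, Finset.mem_univ, true_and, not_not] at hyf hy
          simp [hyf, hg', hgy] at hy
        · simp [hg', hxK]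
      · intro i
        have := congrArg (Int.cast : ℤ → K) (hG g hg i)
        push_cast at this
        simp only [Pi.sub_apply, Pi.smul_apply, smul_eq_mul, mul_sub, Finset.sum_sub_distrib, hf i,
          zero_sub, neg_eq_zero, hg']
        rw [Finset.sum_congr rfl fun x _ => mul_left_comm _ _ _, ← Finset.mul_sum, this, mul_zero]

end System

/-! ### The equations of a homomorphism and the pullback network -/

section Over

variable {T Q : Type*} [Quiver T] [Quiver Q]

/-- There is an arrow `n ⟶ n'` of `T` with image `γ`. -/
def Over (F : T ⥤q Q) (γ : Quiver.Total Q) (n n' : T) : Prop :=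
  ∃ a : Quiver.Total T, a.left = n ∧ a.right = n' ∧ arr F a = γ

theorem Over.nonempty_hom {F : T ⥤q Q} {γ : Quiver.Total Q} {n n' : T} (h : Over F γ n n') :
    Nonempty (n ⟶ n') := by
  obtain ⟨a, rfl, rfl, -⟩ := h
  exact ⟨a.hom⟩

theorem IsTree.adj (hT : IsTree T) {n n' : T} (h : Nonempty (n ⟶ n')) :
    (underlyingGraph T).Adj n n' := by
  obtain ⟨a⟩ := h
  refine (SimpleGraph.fromRel_adj _ _ _).2 ⟨?_, Or.inl ⟨a⟩⟩
  rintro rfl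
  exact (hT.no_loop n).false a

theorem IsTree.total_eq (hT : IsTree T) {a b : Quiver.Total T} (hl : a.left = b.left)
    (hr : a.right = b.right) : a = b := by
  obtain ⟨n, m, a⟩ := a
  obtain ⟨n', m', b⟩ := b
  obtain rfl : n = n' := hl
  obtain rfl : m = m' := hr
  have := (hT.simple n m).elim (Sum.inl a) (Sum.inl b)
  rw [Sum.inl.inj this]

theorem IsTree.not_nonempty_hom (hT : IsTree T) {n m : T} (h : Nonempty (n ⟶ m)) :
    ¬ Nonempty (m ⟶ n) := by
  rintro ⟨b⟩
  obtain ⟨a⟩ := h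
  exact Sum.inl_ne_inr ((hT.simple n m).elim (Sum.inl a) (Sum.inr b))

variable {F : T ⥤q Q} {γ γ' γ'' : Quiver.Total Q} {n n₁ n₂ n₃ p q r : T}

theorem Over.ne (h : Over F γ p n) (hT : IsTree T) : p ≠ n := (hT.adj h.nonempty_hom).ne

theorem Over.asymm (h : Over F γ p n) (hT : IsTree T) : ¬ Over F γ' n p := fun h' =>
  hT.not_nonempty_hom h.nonempty_hom h'.nonempty_hom

theorem Over.label_unique (h : Over F γ p n) (h' : Over F γ' p n) (hT : IsTree T) : γ = γ' := by
  obtain ⟨a, ha, ha', rfl⟩ := h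
  obtain ⟨b, hb, hb', rfl⟩ := h'
  rw [hT.total_eq (ha.trans hb.symm) (ha'.trans hb'.symm)]

/-- The facts from here to the end of the section are the forest lemmas in terms of labelled arrows,
in the form needed by the case analysis of `Occurs.eq_of_pairwise`. -/
theorem Over.source_unique (h₁ : Over F γ p n₁) (h₂ : Over F γ p n₂) (h₁' : Over F γ' q n₁)
    (h₂' : Over F γ'' q n₂) (hne : n₁ ≠ n₂) (hT : IsTree T) : p = q :=
  hT.isTree.isAcyclic.eq_of_adj_adj hne (hT.adj h₁.nonempty_hom).symm (hT.adj h₂.nonempty_hom)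
    (hT.adj h₁'.nonempty_hom).symm (hT.adj h₂'.nonempty_hom)

theorem Over.target_unique (h₁ : Over F γ n₁ p) (h₂ : Over F γ n₂ p) (h₁' : Over F γ' n₁ q)
    (h₂' : Over F γ'' n₂ q) (hne : n₁ ≠ n₂) (hT : IsTree T) : p = q :=
  hT.isTree.isAcyclic.eq_of_adj_adj hne (hT.adj h₁.nonempty_hom) (hT.adj h₂.nonempty_hom).symm
    (hT.adj h₁'.nonempty_hom) (hT.adj h₂'.nonempty_hom).symm

/-- There are no alternating squares in a tree. -/
theorem Over.no_square (h₁ : Over F γ p n₁) (h₂ : Over F γ p n₂) (h₁' : Over F γ' n₁ q)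
    (h₂' : Over F γ'' n₂ q) (hne : n₁ ≠ n₂) (hT : IsTree T) : False := by
  obtain rfl : p = q := hT.isTree.isAcyclic.eq_of_adj_adj hne (hT.adj h₁.nonempty_hom).symm
    (hT.adj h₂.nonempty_hom) (hT.adj h₁'.nonempty_hom) (hT.adj h₂'.nonempty_hom).symm
  exact h₁.asymm hT h₁'

theorem Over.no_triangle (h₁ : Over F γ p n₁) (h₂ : Over F γ' p n₂) (h₃ : Over F γ'' n₁ n₂)
    (hT : IsTree T) : False :=
  hT.isTree.isAcyclic.not_adj_of_adj_adj (hT.adj h₁.nonempty_hom) (hT.adj h₃.nonempty_hom)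
    (hT.adj h₂.nonempty_hom)

theorem Over.no_cyclic_triangle (h₁ : Over F γ p n₁) (h₂ : Over F γ' n₂ p) (h₃ : Over F γ'' n₁ n₂)
    (hT : IsTree T) : False :=
  hT.isTree.isAcyclic.not_adj_of_adj_adj (hT.adj h₁.nonempty_hom) (hT.adj h₃.nonempty_hom)
    (hT.adj h₂.nonempty_hom).symm

theorem Over.source_unique_of_three (h₁ : Over F γ p n₁) (h₂ : Over F γ p n₂)
    (h₂' : Over F γ' q n₂) (h₃' : Over F γ' q n₃) (h₁'' : Over F γ'' r n₁) (h₃'' : Over F γ'' r n₃)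
    (h12 : n₁ ≠ n₂) (h23 : n₂ ≠ n₃) (h13 : n₁ ≠ n₃) (hT : IsTree T) : p = q :=
  hT.isTree.isAcyclic.eq_of_pairwise_adj_adj h12 h23 h13
    (hT.adj h₁.nonempty_hom).symm (hT.adj h₂.nonempty_hom)
    (hT.adj h₂'.nonempty_hom).symm (hT.adj h₃'.nonempty_hom)
    (hT.adj h₁''.nonempty_hom).symm (hT.adj h₃''.nonempty_hom)

theorem Over.target_unique_of_three (h₁ : Over F γ n₁ p) (h₂ : Over F γ n₂ p)
    (h₂' : Over F γ' n₂ q) (h₃' : Over F γ' n₃ q) (h₁'' : Over F γ'' n₁ r) (h₃'' : Over F γ'' n₃ r)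
    (h12 : n₁ ≠ n₂) (h23 : n₂ ≠ n₃) (h13 : n₁ ≠ n₃) (hT : IsTree T) : p = q :=
  hT.isTree.isAcyclic.eq_of_pairwise_adj_adj h12 h23 h13
    (hT.adj h₁.nonempty_hom) (hT.adj h₂.nonempty_hom).symm
    (hT.adj h₂'.nonempty_hom) (hT.adj h₃'.nonempty_hom).symm
    (hT.adj h₁''.nonempty_hom) (hT.adj h₃''.nonempty_hom).symm

end Over

/-! ### Pairs of vertices occurring in a common equation -/

section Equations

variable {T₁ T₂ Q : Type*} [Quiver T₁] [Quiver T₂] [Quiver Q]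

/-- The pair `x` occurs in the equation which compares the coefficients of `γ (f v_n)` and
`f (γ v_n)` at `m'`, where `i = (n, γ, m')`. -/
def Occurs (F₁ : T₁ ⥤q Q) (F₂ : T₂ ⥤q Q) (i : T₁ × Quiver.Total Q × T₂) (x : T₁ × T₂) : Prop :=
  (x.2 = i.2.2 ∧ Over F₁ i.2.1 i.1 x.1) ∨ (x.1 = i.1 ∧ Over F₂ i.2.1 x.2 i.2.2)

variable {F₁ : T₁ ⥤q Q} {F₂ : T₂ ⥤q Q}

/-- Three distinct pairs, any two of which occur in a common equation, occur in the same
equation. -/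
theorem Occurs.eq_of_pairwise (hT₁ : IsTree T₁) (hT₂ : IsTree T₂)
    {i j k : T₁ × Quiver.Total Q × T₂} {x y z : T₁ × T₂} (hxy : x ≠ y) (hyz : y ≠ z) (hxz : x ≠ z)
    (hxi : Occurs F₁ F₂ i x) (hyi : Occurs F₁ F₂ i y) (hyj : Occurs F₁ F₂ j y)
    (hzj : Occurs F₁ F₂ j z) (hxk : Occurs F₁ F₂ k x) (hzk : Occurs F₁ F₂ k z) : i = j := by
  obtain ⟨n, γ, m⟩ := i
  obtain ⟨n', γ', m'⟩ := j
  obtain ⟨n'', γ'', m''⟩ := k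
  obtain ⟨x, x'⟩ := x
  obtain ⟨y, y'⟩ := y
  obtain ⟨z, z'⟩ := z
  simp only [Occurs, ne_eq, Prod.mk.injEq] at *
  -- Each of the six occurrences is on one of the two sides of its equation; every resulting case
  -- either coincides or contradicts acyclicity.
  rcases hxi with ⟨rfl, a1⟩ | ⟨rfl, a1⟩ <;> rcases hyi with ⟨rfl, a2⟩ | ⟨rfl, a2⟩ <;>
  rcases hyj with ⟨rfl, a3⟩ | ⟨rfl, a3⟩ <;> rcases hzj with ⟨rfl, a4⟩ | ⟨rfl, a4⟩ <;>
  rcases hxk with ⟨rfl, a5⟩ | ⟨rfl, a5⟩ <;> rcases hzk with ⟨h6, a6⟩ | ⟨h6, a6⟩ <;>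
  grind [Over.ne, Over.asymm, Over.label_unique, Over.source_unique, Over.target_unique, Over.no_square,
    Over.no_triangle, Over.no_cyclic_triangle, Over.source_unique_of_three,
    Over.target_unique_of_three]

/-- An arrow links terms on opposite sides of an equation, an edge links terms on the same side. -/
theorem exists_occurs_of_linked {x y : (pullbackNetwork F₁ F₂).V}
    (h : (pullbackNetwork F₁ F₂).Linked x y) :
    ∃ i, Occurs F₁ F₂ i x.1 ∧ Occurs F₁ F₂ i y.1 := by
  have key : ∀ a : (pullbackNetwork F₁ F₂).A,
      Occurs F₁ F₂ (a.1.1.left, arr F₁ a.1.1, a.1.2.right) ((pullbackNetwork F₁ F₂).src a).1 ∧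
      Occurs F₁ F₂ (a.1.1.left, arr F₁ a.1.1, a.1.2.right) ((pullbackNetwork F₁ F₂).tgt a).1 :=
    fun a => ⟨Or.inr ⟨rfl, _, rfl, rfl, a.2.symm⟩, Or.inl ⟨rfl, _, rfl, rfl, rfl⟩⟩
  rcases h with (⟨h, -, a, b, hab, ha, hb, hF⟩ | ⟨h, -, c, d, hcd, hc, hd, hF⟩) |
    ⟨a, ⟨rfl, rfl⟩ | ⟨rfl, rfl⟩⟩
  · exact ⟨(a.left, arr F₁ a, x.1.2), Or.inl ⟨rfl, a, rfl, ha, rfl⟩,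
      Or.inl ⟨h.symm, b, hab.symm, hb, hF.symm⟩⟩
  · exact ⟨(x.1.1, arr F₂ c, c.right), Or.inr ⟨rfl, c, hc, rfl, rfl⟩,
      Or.inr ⟨h.symm, d, hd, hcd.symm, hF.symm⟩⟩
  · exact ⟨_, key a⟩
  · exact ⟨_, (key a).symm⟩

end Equations

/-! ### Components of matchings as subnetworks of the cover -/

section MatchingNetwork

variable {T₁ T₂ Q : Type*} [Quiver T₁] [Quiver T₂] [Quiver Q] [Fintype T₁] [Fintype T₂]

open Classical in
noncomputable instance (F₁ : T₁ ⥤q Q) (F₂ : T₂ ⥤q Q) : Fintype (pullbackNetwork F₁ F₂).V :=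
  inferInstanceAs (Fintype {x : T₁ × T₂ // F₁.obj x.1 = F₂.obj x.2})

open Classical in
/-- The set of vertices of the pullback network which occur in the equation `i`. -/
noncomputable def eqSet (F₁ : T₁ ⥤q Q) (F₂ : T₂ ⥤q Q) (i : T₁ × Quiver.Total Q × T₂) :
    Finset (pullbackNetwork F₁ F₂).V :=
  {x | Occurs F₁ F₂ i x.1}

open Classical in
/-- The sign of a vertex of the pullback network in the equation `i`. -/
noncomputable def eqSign (F₁ : T₁ ⥤q Q) (F₂ : T₂ ⥤q Q) (i : T₁ × Quiver.Total Q × T₂)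
    (x : (pullbackNetwork F₁ F₂).V) : ℤˣ :=
  if x.1.2 = i.2.2 then 1 else -1

variable {F₁ : T₁ ⥤q Q} {F₂ : T₂ ⥤q Q}

theorem mem_eqSet {i : T₁ × Quiver.Total Q × T₂} {x : (pullbackNetwork F₁ F₂).V} :
    x ∈ eqSet F₁ F₂ i ↔ Occurs F₁ F₂ i x.1 := by
  simp [eqSet]

variable {S : Finset (pullbackNetwork F₁ F₂).V}
  {μ : T₁ × Quiver.Total Q × T₂ → (pullbackNetwork F₁ F₂).V × ℤˣ →
    (pullbackNetwork F₁ F₂).V × ℤˣ → Prop}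

/-- Matched signed vertices which both contribute to `f (γ v_n)` are joined by an edge of the
cover. -/
theorem IsMatching.adj_of_left (hμ : IsMatching (eqSet F₁ F₂) (eqSign F₁ F₂) S μ)
    {i : T₁ × Quiver.Total Q × T₂} {p q : (pullbackNetwork F₁ F₂).V × ℤˣ} (h : μ i p q)
    (hp : p.1.1.2 = i.2.2) (hp' : Over F₁ i.2.1 i.1 p.1.1.1)
    (hq : q.1.1.2 = i.2.2) (hq' : Over F₁ i.2.1 i.1 q.1.1.1) :
    (coverNetwork F₁ F₂).graph.Adj p q := by
  obtain ⟨a, ha1, ha2, ha3⟩ := hp'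
  obtain ⟨b, hb1, hb2, hb3⟩ := hq'
  refine ⟨Or.inl ⟨hp.trans hq.symm, fun h' => hμ.ne h (Subtype.ext (Prod.ext h'
    (hp.trans hq.symm))), a, b, ha1.trans hb1.symm, ha2, hb2, ha3.trans hb3.symm⟩, ?_⟩
  have := hμ.sign h
  simp only [eqSign, hp, hq, if_true, one_mul] at this
  rw [this, neg_neg]

/-- Matched signed vertices which both contribute to `γ (f v_n)` are joined by an edge of the
cover. -/
theorem IsMatching.adj_of_right (hμ : IsMatching (eqSet F₁ F₂) (eqSign F₁ F₂) S μ)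
    (hT₂ : IsTree T₂)
    {i : T₁ × Quiver.Total Q × T₂} {p q : (pullbackNetwork F₁ F₂).V × ℤˣ} (h : μ i p q)
    (hp : p.1.1.1 = i.1) (hp' : Over F₂ i.2.1 p.1.1.2 i.2.2)
    (hq : q.1.1.1 = i.1) (hq' : Over F₂ i.2.1 q.1.1.2 i.2.2) :
    (coverNetwork F₁ F₂).graph.Adj p q := by
  have hpne := hp'.ne hT₂
  have hqne := hq'.ne hT₂
  obtain ⟨a, ha1, ha2, ha3⟩ := hp'
  obtain ⟨b, hb1, hb2, hb3⟩ := hq'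
  refine ⟨Or.inr ⟨hp.trans hq.symm, fun h' => hμ.ne h (Subtype.ext (Prod.ext
    (hp.trans hq.symm) h')), a, b, ha2.trans hb2.symm, ha1, hb1, ha3.trans hb3.symm⟩, ?_⟩
  have := hμ.sign h
  simp only [eqSign, hpne, hqne, if_false, neg_mul, one_mul, neg_neg] at this
  rw [← this]

/-- Matched signed vertices which contribute to different sides of the equation have the same
sign. -/
theorem IsMatching.snd_eq (hμ : IsMatching (eqSet F₁ F₂) (eqSign F₁ F₂) S μ) (hT₂ : IsTree T₂)
    {i : T₁ × Quiver.Total Q × T₂} {p q : (pullbackNetwork F₁ F₂).V × ℤˣ} (h : μ i p q)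
    (hp' : Over F₂ i.2.1 p.1.1.2 i.2.2) (hq : q.1.1.2 = i.2.2) :
    p.2 = q.2 := by
  have := hμ.sign h
  simpa only [eqSign, hp'.ne hT₂, hq, if_true, if_false, neg_mul, one_mul, neg_inj] using this

/-- The subnetwork of the cover on a component of a matching. -/
def matchingSub (hμ : IsMatching (eqSet F₁ F₂) (eqSign F₁ F₂) S μ)
    (p : (pullbackNetwork F₁ F₂).V × ℤˣ) : (coverNetwork F₁ F₂).Sub where
  verts := IsMatching.component μ p
  Adj x y := x ∈ IsMatching.component μ p ∧ (coverNetwork F₁ F₂).graph.Adj x y ∧ ∃ i, μ i x y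
  adj_sub h := h.2.1
  edge_vert h := h.1
  symm := ⟨fun _ _ ⟨h, h', i, hi⟩ =>
    ⟨IsMatching.mem_component_of_match h hi, h'.symm, i, hμ.symm hi⟩⟩
  arrows := {a | (coverNetwork F₁ F₂).src a ∈ IsMatching.component μ p ∧
    ∃ i, μ i ((coverNetwork F₁ F₂).src a) ((coverNetwork F₁ F₂).tgt a)}
  src_mem _ h := h.1
  tgt_mem _ := fun ⟨h, _, hi⟩ => IsMatching.mem_component_of_match h hi

variable {p : (pullbackNetwork F₁ F₂).V × ℤˣ}

theorem exists_match_of_linked_matchingSub (hμ : IsMatching (eqSet F₁ F₂) (eqSign F₁ F₂) S μ)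
    {x y : (pullbackNetwork F₁ F₂).V × ℤˣ} (h : (matchingSub hμ p).Linked x y) :
    ∃ i, μ i x y := by
  rcases h with ⟨-, -, h⟩ | ⟨a, ⟨-, i, h⟩, ⟨rfl, rfl⟩ | ⟨rfl, rfl⟩⟩
  · exact h
  · exact ⟨i, h⟩
  · exact ⟨i, hμ.symm h⟩

/-- Here `x` contributes to γ (f v_n) and `y` to f (γ v_n). Being on opposite sides they match with
equal signs, so the arrow `(a, b)` lifts to their common sheet. -/
theorem exists_mem_arrows_matchingSub (hμ : IsMatching (eqSet F₁ F₂) (eqSign F₁ F₂) S μ)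
    (hT₂ : IsTree T₂)
    {i : T₁ × Quiver.Total Q × T₂} {x y : (pullbackNetwork F₁ F₂).V × ℤˣ}
    (hx : x ∈ IsMatching.component μ p) (h : μ i x y) {a : Quiver.Total T₁} {b : Quiver.Total T₂}
    (ha : a.left = x.1.1.1) (ha' : a.right = y.1.1.1) (hb : b.left = x.1.1.2)
    (hb' : b.right = y.1.1.2) (hFa : arr F₁ a = i.2.1) (hFb : arr F₂ b = i.2.1)
    (hy : y.1.1.2 = i.2.2) :
    ∃ c ∈ (matchingSub hμ p).arrows, c.1.1 = (a, b) ∧ (coverNetwork F₁ F₂).src c = x ∧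
      (coverNetwork F₁ F₂).tgt c = y := by
  have hsnd := hμ.snd_eq hT₂ h ⟨b, hb, hb'.trans hy, hFb⟩ hy
  obtain ⟨⟨⟨x₁, x₂⟩, hx'⟩, j⟩ := x
  obtain ⟨⟨⟨y₁, y₂⟩, hy'⟩, k⟩ := y
  dsimp only at ha ha' hb hb' hsnd
  subst ha ha' hb hb' hsnd
  exact ⟨(⟨(a, b), hFa.trans hFb.symm⟩, j), ⟨hx, i, h⟩, rfl, rfl, rfl⟩

theorem linked_matchingSub_of_match (hμ : IsMatching (eqSet F₁ F₂) (eqSign F₁ F₂) S μ)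
    (hT₂ : IsTree T₂)
    {x y : (pullbackNetwork F₁ F₂).V × ℤˣ} {i : T₁ × Quiver.Total Q × T₂}
    (hx : x ∈ IsMatching.component μ p) (h : μ i x y) : (matchingSub hμ p).Linked x y := by
  rcases mem_eqSet.1 (hμ.mem_left h) with ⟨h1, h2⟩ | ⟨h1, h2⟩ <;>
    rcases mem_eqSet.1 (hμ.mem_left (hμ.symm h)) with ⟨h3, h4⟩ | ⟨h3, h4⟩
  · exact Or.inl ⟨hx, hμ.adj_of_left h h1 h2 h3 h4, i, h⟩
  · obtain ⟨a, ha, ha', hFa⟩ := h2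
    obtain ⟨b, hb, hb', hFb⟩ := h4
    obtain ⟨c, hc, -, hs, ht⟩ := exists_mem_arrows_matchingSub hμ hT₂
      (IsMatching.mem_component_of_match hx h) (hμ.symm h) (ha.trans h3.symm) ha' hb
      (hb'.trans h1.symm) hFa hFb h1
    exact Or.inr ⟨c, hc, Or.inr ⟨hs, ht⟩⟩
  · obtain ⟨a, ha, ha', hFa⟩ := h4
    obtain ⟨b, hb, hb', hFb⟩ := h2
    obtain ⟨c, hc, -, hs, ht⟩ := exists_mem_arrows_matchingSub hμ hT₂ hx h (ha.trans h1.symm) ha' hb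
      (hb'.trans h3.symm) hFa hFb h3
    exact Or.inr ⟨c, hc, Or.inl ⟨hs, ht⟩⟩
  · exact Or.inl ⟨hx, hμ.adj_of_right hT₂ h h1 h2 h3 h4, i, h⟩

theorem connected_matchingSub (hμ : IsMatching (eqSet F₁ F₂) (eqSign F₁ F₂) S μ)
    (hT₂ : IsTree T₂) : (matchingSub hμ p).Connected := by
  rw [Network.Sub.Connected, SimpleGraph.connected_iff_exists_forall_reachable]
  refine ⟨⟨p, IsMatching.mem_component_self p⟩, ?_⟩
  rintro ⟨q, hq⟩
  change Relation.ReflTransGen _ _ _ at hq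
  induction hq with
  | refl => rfl
  | tail hx h ih =>
    obtain ⟨i, h⟩ := h
    refine ih.trans (SimpleGraph.Adj.reachable ((SimpleGraph.fromRel_adj _ _ _).2 ⟨?_, Or.inl ?_⟩))
    · exact fun h' => hμ.ne h (congrArg (fun x => x.1.1) h')
    · exact linked_matchingSub_of_match hμ hT₂ hx h

/-- Three pairwise linked vertices share one equation, and there the middle one has a unique
partner, so the outer two would coincide. -/
theorem blockedFree_matchingSub (hμ : IsMatching (eqSet F₁ F₂) (eqSign F₁ F₂) S μ)
    (hT₁ : IsTree T₁) (hT₂ : IsTree T₂) : (matchingSub hμ p).BlockedFree := by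
  rintro x y z hxy hyz ⟨hne, hne', hne'', -, -, hxz⟩
  obtain ⟨i, hi⟩ := exists_match_of_linked_matchingSub hμ hxy
  obtain ⟨j, hj⟩ := exists_match_of_linked_matchingSub hμ hyz
  obtain ⟨k, hk, hk'⟩ := exists_occurs_of_linked hxz
  obtain rfl : i = j := Occurs.eq_of_pairwise hT₁ hT₂ (Subtype.coe_injective.ne hne)
    (Subtype.coe_injective.ne hne') (Subtype.coe_injective.ne hne'') (mem_eqSet.1 (hμ.mem_left hi))
    (mem_eqSet.1 (hμ.mem_left (hμ.symm hi))) (mem_eqSet.1 (hμ.mem_left hj))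
    (mem_eqSet.1 (hμ.mem_left (hμ.symm hj))) hk hk'
  exact hne'' (congrArg Prod.fst (hμ.unique (hμ.symm hi) hj))

/-- Each arrow in the completeness condition singles out an equation in which the vertex occurs. Its
partner there provides the edge if it lies on the same side, and the arrow otherwise. -/
theorem isComplete_matchingSub (hμ : IsMatching (eqSet F₁ F₂) (eqSign F₁ F₂) S μ)
    (hT₂ : IsTree T₂) (hp : p.1 ∈ S) : IsComplete (matchingSub hμ p) := by
  intro x j hx
  have hxS : x ∈ S := hμ.mem_support_of_mem_component hp hx
  constructor
  · intro a ha
    have ho : Occurs F₁ F₂ (a.left, arr F₁ a, x.1.2) x.1 := Or.inl ⟨rfl, a, rfl, ha, rfl⟩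
    obtain ⟨⟨y, k⟩, h⟩ := hμ.exists_match (p := (x, j)) (mem_eqSet.2 ho) hxS
    rcases mem_eqSet.1 (hμ.mem_left (hμ.symm h)) with ⟨h3, h4⟩ | ⟨h3, h4⟩
    · right
      have hadj := hμ.adj_of_left h rfl ⟨a, rfl, ha, rfl⟩ h3 h4
      obtain ⟨c, hc, hc', hFc⟩ := h4
      obtain rfl : k = -j := hadj.2
      exact ⟨c, hc, hFc.symm, y, Prod.ext hc'.symm h3, hx, hadj, _, h⟩
    · left
      obtain ⟨b, hb, hb', hFb⟩ := h4
      obtain ⟨c, hc, hcab, -, ht⟩ := exists_mem_arrows_matchingSub hμ hT₂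
        (IsMatching.mem_component_of_match hx h) (hμ.symm h) (a := a) (b := b) h3.symm ha hb
        hb' rfl hFb rfl
      exact ⟨c, hc, congrArg Prod.fst hcab, ht⟩
  · intro b hb
    have ho : Occurs F₁ F₂ (x.1.1, arr F₂ b, b.right) x.1 := Or.inr ⟨rfl, b, hb, rfl, rfl⟩
    obtain ⟨⟨y, k⟩, h⟩ := hμ.exists_match (p := (x, j)) (mem_eqSet.2 ho) hxS
    rcases mem_eqSet.1 (hμ.mem_left (hμ.symm h)) with ⟨h3, h4⟩ | ⟨h3, h4⟩
    · left
      obtain ⟨a, ha, ha', hFa⟩ := h4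
      obtain ⟨c, hc, hcab, hs, -⟩ := exists_mem_arrows_matchingSub hμ hT₂ hx h (a := a) (b := b)
        ha ha' hb h3.symm hFa rfl h3
      exact ⟨c, hc, congrArg Prod.snd hcab, hs⟩
    · right
      have hadj := hμ.adj_of_right hT₂ h rfl ⟨b, hb, rfl, rfl⟩ h3 h4
      obtain ⟨d, hd, hd', hFd⟩ := h4
      obtain rfl : k = -j := hadj.2
      exact ⟨d, hd', hFd.symm, y, Prod.ext h3 hd.symm, hx, hadj, _, h⟩

/-- Every non-empty unforced set of vertices contains the support of a `0, ±1`-valued solution of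
the equations which is supported by a generalised graph map. -/
theorem exists_solution_of_isUnforced (hT₁ : IsTree T₁) (hT₂ : IsTree T₂)
    (hghost : GhostFree F₁ F₂) (S : Finset (pullbackNetwork F₁ F₂).V) (hS : S.Nonempty)
    (hSu : IsUnforced (eqSet F₁ F₂) S) :
    ∃ g : (pullbackNetwork F₁ F₂).V → ℤ,
      ((∀ i, ∑ x ∈ eqSet F₁ F₂ i, (eqSign F₁ F₂ i x : ℤ) * g x = 0) ∧
        ∀ x, g x ≠ 0 → ∃ j, InGenGraphMap F₁ F₂ x.1.1 x.1.2 j) ∧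
      (∀ x, g x ≠ 0 → x ∈ S) ∧ ∃ x ∈ S, IsUnit (g x) := by
  -- Minimality is what forces a component with a repeated variable to be involution-invariant,
  -- hence a ghost.
  obtain ⟨S', hS', ⟨⟨x₀, hx₀⟩, hSu'⟩, hmin⟩ := exists_minimal_le_of_wellFoundedLT
    (fun S => S.Nonempty ∧ IsUnforced (eqSet F₁ F₂) S) S ⟨hS, hSu⟩
  replace hmin : ∀ S'' ⊆ S', S''.Nonempty → IsUnforced (eqSet F₁ F₂) S'' → S'' = S' :=
    fun S'' h h' h'' => h.antisymm (hmin ⟨h', h''⟩ h)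
  obtain ⟨μ, hμ⟩ := hSu'.exists_isMatching (eqSign F₁ F₂)
  have hp : ((x₀, 1) : (pullbackNetwork F₁ F₂).V × ℤˣ).1 ∈ S' := hx₀
  have hfree : ∀ x j, (x, j) ∈ IsMatching.component μ (x₀, 1) →
      (x, -j) ∉ IsMatching.component μ (x₀, 1) := by
    intro x j h h'
    refine hghost (matchingSub hμ (x₀, 1)) ⟨connected_matchingSub hμ hT₂, fun y k hy => ?_,
      isComplete_matchingSub hμ hT₂ hp, blockedFree_matchingSub hμ hT₁ hT₂⟩
    exact hμ.mem_component_of_mem_of_neg_mem hmin hp h h'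
      (hμ.mem_support_of_mem_component hp hy :)
  have hggm : IsGenGraphMap (matchingSub hμ (x₀, 1)) := ⟨connected_matchingSub hμ hT₂, hfree,
    isComplete_matchingSub hμ hT₂ hp, blockedFree_matchingSub hμ hT₁ hT₂⟩
  have hmem : ∀ x, IsMatching.signFun (IsMatching.component μ (x₀, 1)) x ≠ 0 →
      ∃ j, (x, j) ∈ IsMatching.component μ (x₀, 1) := fun x hx => by
    by_contra h
    exact hx (IsMatching.signFun_eq_zero h)
  refine ⟨IsMatching.signFun (IsMatching.component μ (x₀, 1)),
    ⟨hμ.sum_signFun_eq_zero hp hfree, fun x hx => ?_⟩, fun x hx => ?_, x₀, hS' hx₀, ?_⟩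
  · obtain ⟨j, hj⟩ := hmem x hx
    exact ⟨j, _, hggm, x.2, hj⟩
  · obtain ⟨j, hj⟩ := hmem x hx
    exact hS' (hμ.mem_support_of_mem_component hp hj)
  · rw [IsMatching.signFun_eq hfree (IsMatching.mem_component_self _)]
    exact Units.isUnit _

end MatchingNetwork

/-! ### Endomorphisms as matrices -/

section EndAlgebra

variable {T Q : Type*} [Quiver T] [Quiver Q] {F : T ⥤q Q}

/-- Extension of a function on the vertices of the pullback network by zero. -/
noncomputable def extendMatrix (R : Type*) [CommRing R] (F : T ⥤q Q) :
    ((pullbackNetwork F F).V → R) →ₗ[R] Matrix T T R := by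
  classical
  exact
  { toFun := fun f => Matrix.of fun n m => if h : F.obj n = F.obj m then f ⟨(n, m), h⟩ else 0
    map_add' := fun f g => by
      ext n m
      by_cases h : F.obj n = F.obj m
      · simp [h]
        rfl
      · simp [h]
    map_smul' := fun c f => by
      ext n m
      by_cases h : F.obj n = F.obj m
      · simp [h]
        rfl
      · simp [h] }

theorem extendMatrix_apply_of_eq {R : Type*} [CommRing R] (f : (pullbackNetwork F F).V → R)
    {n m : T} (h : F.obj n = F.obj m) : extendMatrix R F f n m = f ⟨(n, m), h⟩ :=
  dif_pos h

theorem extendMatrix_apply_of_ne {R : Type*} [CommRing R] (f : (pullbackNetwork F F).V → R)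
    {n m : T} (h : F.obj n ≠ F.obj m) : extendMatrix R F f n m = 0 :=
  dif_neg h

open Classical in
/-- The matrix of the action of the arrow `γ`. -/
noncomputable def overMatrix (R : Type*) [CommRing R] (F : T ⥤q Q) (γ : Quiver.Total Q) :
    Matrix T T R :=
  Matrix.of fun n n' => if Over F γ n n' then 1 else 0

variable [Fintype T]

open Classical in
theorem overMatrix_mul_apply {R : Type*} [CommRing R] (A : Matrix T T R) (γ : Quiver.Total Q)
    (n m : T) : (overMatrix R F γ * A) n m = ∑ p, if Over F γ n p then A p m else 0 := by
  simp [overMatrix, Matrix.mul_apply]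

open Classical in
theorem mul_overMatrix_apply {R : Type*} [CommRing R] (A : Matrix T T R) (γ : Quiver.Total Q)
    (n m : T) : (A * overMatrix R F γ) n m = ∑ q, if Over F γ q m then A n q else 0 := by
  simp [overMatrix, Matrix.mul_apply]

/-- This identifies the equation at `(n, γ, m)` with an entry of a commutator, so that solutions of
the system are the matrices in `endAlgebra`. -/
theorem sum_eqSet {R : Type*} [CommRing R] (hT : IsTree T) {A : Matrix T T R}
    (hA : ∀ n m, F.obj n ≠ F.obj m → A n m = 0) (n : T) (γ : Quiver.Total Q) (m : T) :
    ∑ x ∈ eqSet F F (n, γ, m), ((eqSign F F (n, γ, m) x : ℤ) : R) * A x.1.1 x.1.2 =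
      (overMatrix R F γ * A) n m - (A * overMatrix R F γ) n m := by
  classical
  let h : T × T → R := fun x => (if x.2 = m then if Over F γ n x.1 then A x.1 x.2 else 0 else 0) -
    (if x.1 = n then if Over F γ x.2 m then A x.1 x.2 else 0 else 0)
  have h1 : ∑ x ∈ eqSet F F (n, γ, m), ((eqSign F F (n, γ, m) x : ℤ) : R) * A x.1.1 x.1.2 =
      ∑ x : (pullbackNetwork F F).V, h x.1 := by
    rw [eqSet, Finset.sum_filter]
    refine Finset.sum_congr rfl ?_
    rintro ⟨⟨x, y⟩, hxy⟩ -
    -- Absence of loops makes the two ways of occurring exclusive, which justifies a sign depending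
    -- on the second coordinate alone.
    have hl := fun h : Over F γ y m => h.ne hT
    have hr := fun h : Over F γ n x => h.ne hT
    simp only [Occurs, eqSign, h]
    by_cases h1 : y = m <;> by_cases h2 : x = n <;> by_cases h3 : Over F γ n x <;>
      by_cases h4 : Over F γ y m <;> simp_all
  have h2 : ∑ x : (pullbackNetwork F F).V, h x.1 = ∑ x : T × T, h x := by
    refine (Finset.sum_subtype {x : T × T | F.obj x.1 = F.obj x.2} (by simp) h).symm.trans
      (Finset.sum_subset (Finset.subset_univ _) fun x _ hx => ?_)
    simp only [Finset.mem_filter, Finset.mem_univ, true_and] at hx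
    simp [h, hA x.1 x.2 hx]
  rw [h1, h2, Fintype.sum_prod_type, overMatrix_mul_apply, mul_overMatrix_apply]
  simp only [h, Finset.sum_sub_distrib, Finset.sum_ite_eq', Finset.mem_univ, if_true]
  congr 1
  rw [Finset.sum_comm]
  simp only [Finset.sum_ite_eq', Finset.mem_univ, if_true]

variable [DecidableEq T]

/-- The algebra of the matrices of endomorphisms of the generalised tree module given by `F`. The
entry at `n, m` is the coefficient of `v_m` in the image of `v_n`. -/
noncomputable def endAlgebra (R : Type*) [CommRing R] (F : T ⥤q Q) :
    Subalgebra R (Matrix T T R) where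
  carrier := {A | (∀ n m, F.obj n ≠ F.obj m → A n m = 0) ∧
    ∀ γ, overMatrix R F γ * A = A * overMatrix R F γ}
  mul_mem' := by
    rintro A B ⟨hA, hA'⟩ ⟨hB, hB'⟩
    refine ⟨fun n m h => ?_, fun γ => ?_⟩
    · rw [Matrix.mul_apply]
      refine Finset.sum_eq_zero fun k _ => ?_
      by_cases hk : F.obj n = F.obj k
      · rw [hB k m (hk ▸ h), mul_zero]
      · rw [hA n k hk, zero_mul]
    · rw [← mul_assoc, hA', mul_assoc, hB', mul_assoc]
  add_mem' := by
    rintro A B ⟨hA, hA'⟩ ⟨hB, hB'⟩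
    refine ⟨fun n m h => ?_, fun γ => ?_⟩
    · rw [Matrix.add_apply, hA n m h, hB n m h, add_zero]
    · rw [mul_add, add_mul, hA', hB']
  algebraMap_mem' r := by
    refine ⟨fun n m h => ?_, fun γ => ?_⟩
    · rw [Matrix.algebraMap_matrix_apply, if_neg (fun h' => h (congrArg F.obj h'))]
    · exact (Algebra.commutes r _).symm

/-- The arrow matrices have entries 0 and 1, so they are preserved by ring homomorphisms. This
allows passage between ℤ, polynomial rings and fields. -/
theorem map_mem_endAlgebra {R R' : Type*} [CommRing R] [CommRing R'] (φ : R →+* R')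
    {A : Matrix T T R} (hA : A ∈ endAlgebra R F) : A.map φ ∈ endAlgebra R' F := by
  have h : ∀ γ, overMatrix R' F γ = (overMatrix R F γ).map φ := fun γ => by
    ext n m
    by_cases h : Over F γ n m <;> simp [overMatrix, h]
  refine ⟨fun n m h => by simp [hA.1 n m h], fun γ => ?_⟩
  rw [h, ← Matrix.map_mul, hA.2, Matrix.map_mul]

theorem extendMatrix_mem_endAlgebra {R : Type*} [CommRing R] (hT : IsTree T)
    {f : (pullbackNetwork F F).V → R}
    (hf : ∀ i, ∑ x ∈ eqSet F F i, ((eqSign F F i x : ℤ) : R) * f x = 0) :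
    extendMatrix R F f ∈ endAlgebra R F := by
  have h0 : ∀ n m, F.obj n ≠ F.obj m → extendMatrix R F f n m = 0 :=
    fun n m h => extendMatrix_apply_of_ne f h
  refine ⟨h0, fun γ => ?_⟩
  ext n m
  rw [← sub_eq_zero, ← sum_eqSet hT h0, ← hf (n, γ, m)]
  exact Finset.sum_congr rfl fun x _ => by
    rw [extendMatrix_apply_of_eq f x.2]
    rfl

/-- If the pair is ghost-free, the endomorphisms over any field are spanned by integral
endomorphisms supported by generalised graph maps. -/
theorem mem_span_of_mem_endAlgebra {K : Type*} [Field K] (hT : IsTree T) (hghost : GhostFree F F)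
    {A : Matrix T T K} (hA : A ∈ endAlgebra K F) :
    A ∈ Submodule.span K ((fun B : Matrix T T ℤ => B.map (Int.castRingHom K)) ''
      {B | B ∈ endAlgebra ℤ F ∧ ∀ n m, B n m ≠ 0 → ∃ j, InGenGraphMap F F n m j}) := by
  have h := mem_span_of_forall_exists (K := K) (mem := eqSet F F) (sg := eqSign F F)
    {g | (∀ i, ∑ x ∈ eqSet F F i, (eqSign F F i x : ℤ) * g x = 0) ∧
      ∀ x, g x ≠ 0 → ∃ j, InGenGraphMap F F x.1.1 x.1.2 j} (fun g hg => hg.1)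
    (exists_solution_of_isUnforced hT hT hghost) (fun x => A x.1.1 x.1.2) (by
      rintro ⟨n, γ, m⟩
      rw [sum_eqSet hT hA.1, hA.2, sub_self])
  have hA' : extendMatrix K F (fun x => A x.1.1 x.1.2) = A := by
    ext n m
    by_cases h : F.obj n = F.obj m
    · rw [extendMatrix_apply_of_eq _ h]
    · rw [extendMatrix_apply_of_ne _ h, hA.1 n m h]
  have h' := Submodule.mem_map_of_mem (f := extendMatrix K F) h
  rw [hA', Submodule.map_span] at h'
  refine Submodule.span_mono ?_ h'
  rintro _ ⟨_, ⟨g, ⟨hg, hg'⟩, rfl⟩, rfl⟩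
  refine ⟨extendMatrix ℤ F g, ⟨extendMatrix_mem_endAlgebra hT (by simpa using hg), ?_⟩, ?_⟩
  · intro n m hnm
    by_cases h : F.obj n = F.obj m
    · rw [extendMatrix_apply_of_eq _ h] at hnm
      exact hg' _ hnm
    · exact absurd (extendMatrix_apply_of_ne _ h) hnm
  · ext n m
    by_cases h : F.obj n = F.obj m
    · simp [extendMatrix_apply_of_eq _ h]
    · simp [extendMatrix_apply_of_ne _ h]

/-- Through this lemma the conditions on generalised graph maps become vanishing statements for
entries of endomorphisms. -/
theorem inGenGraphMap_of_mem_endAlgebra {K : Type*} [Field K] (hT : IsTree T)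
    (hghost : GhostFree F F) {A : Matrix T T K} (hA : A ∈ endAlgebra K F) {n m : T}
    (h : A n m ≠ 0) : ∃ j, InGenGraphMap F F n m j := by
  by_contra hno
  refine h ?_
  have hA' := mem_span_of_mem_endAlgebra hT hghost hA
  clear h hA
  induction hA' using Submodule.span_induction with
  | mem x hx =>
    obtain ⟨B, ⟨-, hB⟩, rfl⟩ := hx
    have : B n m = 0 := by
      by_contra h
      exact hno (hB n m h)
    simp [this]
  | zero => rfl
  | add x y _ _ hx hy => rw [Matrix.add_apply, hx, hy, add_zero]
  | smul a x _ hx => rw [Matrix.smul_apply, hx, smul_zero]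

end EndAlgebra

/-! ### Idempotent endomorphisms -/

section Idempotent

/-- The generic matrix of the family `B`, specialised at `c`. -/
theorem map_eval₂Hom_sum_X_smul {ι K T : Type*} [Fintype ι] [Field K] (B : ι → Matrix T T ℤ)
    (c : ι → K) :
    (∑ i, (MvPolynomial.X i : MvPolynomial ι ℤ) • (B i).map (MvPolynomial.C)).map
      (MvPolynomial.eval₂Hom (Int.castRingHom K) c) =
    ∑ i, c i • (B i).map (Int.castRingHom K) := by
  ext n m
  simp only [Matrix.map_apply, Matrix.sum_apply, Matrix.smul_apply, map_sum, smul_eq_mul, map_mul,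
    MvPolynomial.eval₂Hom_X', MvPolynomial.eval₂Hom_C]

variable {T Q : Type*} [Quiver T] [Quiver Q] [Fintype T] [DecidableEq T] {F : T ⥤q Q}

/-- If entries at siblings vanish, the diagonal of an endomorphism is constant. -/
theorem diag_eq_of_mem_endAlgebra {R : Type*} [CommRing R] (hT : IsTree T) {A : Matrix T T R}
    (hA : A ∈ endAlgebra R F)
    (h : ∀ (a b : Quiver.Total T) (n₁ n₂ : T), n₁ ≠ n₂ → arr F a = arr F b →
      ((a.left = b.left ∧ a.right = n₁ ∧ b.right = n₂) ∨
        (a.right = b.right ∧ a.left = n₁ ∧ b.left = n₂)) → A n₁ n₂ = 0)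
    (n m : T) : A n n = A m m := by
  classical
  -- In the commutation relation at the entry `(a.left, a.right)`, all terms off the diagonal sit at
  -- siblings and vanish; connectedness of the tree then spreads the equality.
  have key : ∀ a : Quiver.Total T, A a.left a.left = A a.right a.right := fun a => by
    have ha : Over F (arr F a) a.left a.right := ⟨a, rfl, rfl, rfl⟩
    have := congrFun (congrFun (hA.2 (arr F a)) a.left) a.right
    rw [overMatrix_mul_apply, mul_overMatrix_apply, Finset.sum_eq_single a.right, if_pos ha,
      Finset.sum_eq_single a.left, if_pos ha] at this
    · exact this.symm
    · intro q _ hq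
      refine ite_eq_right_iff.2 fun ⟨b, hb, hb', hF⟩ => ?_
      exact h a b _ _ hq.symm hF.symm (Or.inr ⟨hb'.symm, rfl, hb⟩)
    · simp
    · intro p _ hp
      refine ite_eq_right_iff.2 fun ⟨b, hb, hb', hF⟩ => ?_
      exact h b a _ _ hp hF (Or.inl ⟨hb, hb', rfl⟩)
    · simp
  obtain ⟨w⟩ := hT.isTree.connected.preconnected n m
  induction w with
  | nil => rfl
  | cons hadj _ ih =>
    rw [← ih]
    rcases ((SimpleGraph.fromRel_adj _ _ _).1 hadj).2 with ⟨⟨a⟩⟩ | ⟨⟨a⟩⟩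
    · exact key ⟨_, _, a⟩
    · exact (key ⟨_, _, a⟩).symm

/-- A surviving term A n m * B m n with m ≠ n would place both (n, m) and (m, n) in generalised
graph maps. -/
theorem mul_apply_diag_of_mem_endAlgebra {K : Type*} [Field K] (hT : IsTree T)
    (hghost : GhostFree F F)
    (h2 : ∀ n₁ n₂ : T, n₁ ≠ n₂ → (∃ j : ℤˣ, InGenGraphMap F F n₁ n₂ j) →
      ¬ ∃ j' : ℤˣ, InGenGraphMap F F n₂ n₁ j')
    {A B : Matrix T T K} (hA : A ∈ endAlgebra K F) (hB : B ∈ endAlgebra K F) (n : T) :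
    (A * B) n n = A n n * B n n := by
  rw [Matrix.mul_apply]
  refine Finset.sum_eq_single_of_mem n (Finset.mem_univ n) fun m _ hm => ?_
  by_contra h
  exact h2 n m hm.symm (inGenGraphMap_of_mem_endAlgebra hT hghost hA (left_ne_zero_of_mul h))
    (inGenGraphMap_of_mem_endAlgebra hT hghost hB (right_ne_zero_of_mul h))

/-- An idempotent endomorphism with zero diagonal vanishes. -/
theorem eq_zero_of_isIdempotentElem_of_diag_eq_zero {K : Type*} [Field K] (hT : IsTree T)
    (hghost : GhostFree F F)
    (h1 : ∀ (a b : Quiver.Total T) (n₁ n₂ : T), n₁ ≠ n₂ → arr F a = arr F b →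
      ((a.left = b.left ∧ a.right = n₁ ∧ b.right = n₂) ∨
        (a.right = b.right ∧ a.left = n₁ ∧ b.left = n₂)) →
      ∀ j : ℤˣ, ¬ InGenGraphMap F F n₁ n₂ j)
    (h2 : ∀ n₁ n₂ : T, n₁ ≠ n₂ → (∃ j : ℤˣ, InGenGraphMap F F n₁ n₂ j) →
      ¬ ∃ j' : ℤˣ, InGenGraphMap F F n₂ n₁ j')
    {A : Matrix T T K} (hA : A ∈ endAlgebra K F) (hid : IsIdempotentElem A)
    (hdiag : ∀ n, A n n = 0) : A = 0 := by
  obtain ⟨t⟩ := hT.isTree.connected.nonempty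
  obtain ⟨N, c, B', hB'⟩ := (Submodule.mem_span_set').1 (mem_span_of_mem_endAlgebra hT hghost hA)
  choose B hB hBB' using fun i => (B' i).2
  have hBdiag : ∀ i n, B i n n = B i t t := fun i n =>
    diag_eq_of_mem_endAlgebra hT (hB i).1 (fun a b n₁ n₂ hne hF hab => by
      by_contra h0
      obtain ⟨j, hj⟩ := (hB i).2 n₁ n₂ h0
      exact h1 a b n₁ n₂ hne hF hab j hj) n t
  -- Subtracting scalars makes the diagonals zero over ℤ. The total correction of `A` is the scalar
  -- ∑ c_i B_i t t, which is the diagonal entry `A t t = 0`.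
  let C : Fin N → Matrix T T ℤ := fun i => B i - algebraMap ℤ _ (B i t t)
  have hC : ∀ i, C i ∈ endAlgebra ℤ F := fun i =>
    sub_mem (hB i).1 (Subalgebra.algebraMap_mem _ _)
  have hCapply : ∀ i n m, C i n m = B i n m - if n = m then B i t t else 0 := fun i n m => by
    simp only [C, Matrix.sub_apply, Matrix.algebraMap_matrix_apply]
    rfl
  have hCdiag : ∀ i n, C i n n = 0 := fun i n => by
    simp [hCapply, hBdiag i n]
  have hAt : ∑ i, c i * (B i t t : K) = 0 := by
    rw [← hdiag t, ← hB', Matrix.sum_apply]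
    exact Finset.sum_congr rfl fun i _ => by simp [← hBB']
  have hAC : ∑ i, c i • (C i).map (Int.castRingHom K) = A := by
    ext n m
    rw [← hB', Matrix.sum_apply, Matrix.sum_apply]
    by_cases hnm : n = m
    · subst hnm
      simp [← hBB', hCdiag, hBdiag _ n, hAt]
    · exact Finset.sum_congr rfl fun i _ => by
        simp [← hBB', hCapply, hnm]
  -- The generic matrix lives over a domain of characteristic zero and specialises to `A` at `X i ↦
  -- c i`.
  let M : Matrix T T (MvPolynomial (Fin N) ℤ) :=
    ∑ i, (MvPolynomial.X i : MvPolynomial (Fin N) ℤ) • (C i).map (MvPolynomial.C)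
  let L := FractionRing (MvPolynomial (Fin N) ℤ)
  let φ : MvPolynomial (Fin N) ℤ →+* L := algebraMap _ _
  have hφ : Function.Injective φ := IsFractionRing.injective _ _
  have : CharZero L := charZero_of_injective_ringHom hφ
  have hM : M.map φ ∈ endAlgebra L F := map_mem_endAlgebra φ (sum_mem fun i _ =>
    Subalgebra.smul_mem _ (map_mem_endAlgebra MvPolynomial.C (hC i)) _)
  have hMdiag : ∀ n, M.map φ n n = 0 := fun n => by
    simp [M, Matrix.sum_apply, hCdiag]
  obtain ⟨k, hk⟩ := isNilpotent_of_trace_pow_eq_zero (M.map φ) fun k => by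
    refine Finset.sum_eq_zero fun n _ => ?_
    rw [Matrix.diag_apply, pow_succ,
      mul_apply_diag_of_mem_endAlgebra hT hghost h2 (pow_mem hM k) hM, hMdiag, mul_zero]
  have hMk : M ^ k = 0 := by
    refine Matrix.map_injective hφ ?_
    change φ.mapMatrix (M ^ k) = φ.mapMatrix 0
    rw [map_pow, map_zero]
    exact hk
  have hAk : A ^ k = 0 := by
    rw [← hAC, ← map_eval₂Hom_sum_X_smul]
    change (RingHom.mapMatrix _ M) ^ k = 0
    rw [← map_pow, hMk, map_zero]
  rw [← hid.pow_succ_eq k, pow_succ, hAk, zero_mul]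

/-- Every idempotent endomorphism is zero or the identity. -/
theorem eq_zero_or_eq_one_of_isIdempotentElem {K : Type*} [Field K] (hT : IsTree T)
    (hghost : GhostFree F F)
    (h1 : ∀ (a b : Quiver.Total T) (n₁ n₂ : T), n₁ ≠ n₂ → arr F a = arr F b →
      ((a.left = b.left ∧ a.right = n₁ ∧ b.right = n₂) ∨
        (a.right = b.right ∧ a.left = n₁ ∧ b.left = n₂)) →
      ∀ j : ℤˣ, ¬ InGenGraphMap F F n₁ n₂ j)
    (h2 : ∀ n₁ n₂ : T, n₁ ≠ n₂ → (∃ j : ℤˣ, InGenGraphMap F F n₁ n₂ j) →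
      ¬ ∃ j' : ℤˣ, InGenGraphMap F F n₂ n₁ j')
    {A : Matrix T T K} (hA : A ∈ endAlgebra K F) (hid : IsIdempotentElem A) :
    A = 0 ∨ A = 1 := by
  obtain ⟨t⟩ := hT.isTree.connected.nonempty
  have hdiag : ∀ n, A n n = A t t := fun n =>
    diag_eq_of_mem_endAlgebra hT hA (fun a b n₁ n₂ hne hF hab => by
      by_contra h0
      obtain ⟨j, hj⟩ := inGenGraphMap_of_mem_endAlgebra hT hghost hA h0
      exact h1 a b n₁ n₂ hne hF hab j hj) n t
  have ht : IsIdempotentElem (A t t) := by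
    rw [IsIdempotentElem, ← mul_apply_diag_of_mem_endAlgebra hT hghost h2 hA hA, hid.eq]
  rcases IsIdempotentElem.iff_eq_zero_or_one.1 ht with h0 | h0
  · exact Or.inl (eq_zero_of_isIdempotentElem_of_diag_eq_zero hT hghost h1 h2 hA hid
      fun n => (hdiag n).trans h0)
  · right
    -- The complementary idempotent `1 - A` has zero diagonal.
    have := eq_zero_of_isIdempotentElem_of_diag_eq_zero hT hghost h1 h2
      (sub_mem (one_mem _) hA) hid.one_sub fun n => by simp [hdiag n, h0]
    exact (sub_eq_zero.1 this).symm

end Idempotent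

/-! ### From endomorphisms of the module to matrices -/

section Fibers

open Classical in
theorem pushdownMap_apply {K T Q : Type*} [Field K] [Quiver T] [Fintype (Quiver.Total T)] [Quiver Q]
    (F : T ⥤q Q) (U : Rep K T) {i j : Q} (γ : i ⟶ j) (y : ∀ n : {n : T // F.obj n = i}, U.obj n.1)
    (m : {n : T // F.obj n = j}) :
    pushdownMap F U γ y m = ∑ a : {a : Quiver.Total T // arr F a = ⟨i, j, γ⟩},
      LinearMap.single K (fun n : {n : T // F.obj n = j} => U.obj n.1)
        ⟨a.1.right, congrArg Quiver.Total.right a.2⟩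
        (U.map a.1.hom (y ⟨a.1.left, congrArg Quiver.Total.left a.2⟩)) m := by
  rw [pushdownMap, LinearMap.sum_apply, Finset.sum_apply]
  rfl

variable {T Q K : Type*} [Quiver T] [Quiver Q] [Field K] {F : T ⥤q Q}

theorem Over.obj_left {γ : Quiver.Total Q} {n m : T} (h : Over F γ n m) : F.obj n = γ.left := by
  obtain ⟨a, rfl, -, rfl⟩ := h
  rfl

theorem Over.obj_right {γ : Quiver.Total Q} {n m : T} (h : Over F γ n m) : F.obj m = γ.right := by
  obtain ⟨a, -, rfl, rfl⟩ := h
  rfl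

theorem sum_eq_sum_fiber [Fintype T] {M : Type*} [AddCommMonoid M] (i : Q)
    [Fintype {n : T // F.obj n = i}] (f : T → M)
    (hf : ∀ n, F.obj n ≠ i → f n = 0) : ∑ n, f n = ∑ n : {n : T // F.obj n = i}, f n.1 := by
  classical
  rw [← Finset.sum_subtype ({n : T | F.obj n = i}) (by simp) f]
  refine (Finset.sum_subset (Finset.subset_univ _) fun n _ hn => hf n (by simpa using hn)).symm

/-- The action of the arrow `γ` on the generalised tree module given by `F`. -/
noncomputable def fiberMap [Fintype (Quiver.Total T)] (K : Type*) [Field K] (F : T ⥤q Q) {i j : Q} (γ : i ⟶ j) :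
    ({n : T // F.obj n = i} → K) →ₗ[K] ({n : T // F.obj n = j} → K) :=
  pushdownMap F (constRep K T) γ

open Classical in
-- A tree has no parallel arrows, so the sum over arrows above `γ` may be replaced by a sum over
-- their sources.
theorem fiberMap_apply [Fintype T] [Fintype (Quiver.Total T)] (hT : IsTree T) {i j : Q}
    (γ : i ⟶ j) (x : {n : T // F.obj n = i} → K) (m : {n : T // F.obj n = j}) :
    fiberMap K F γ x m =
      ∑ q : {n : T // F.obj n = i}, if Over F ⟨i, j, γ⟩ q.1 m.1 then x q else 0 := by
  have h1 : fiberMap K F γ x m = ∑ a : {a : Quiver.Total T // arr F a = ⟨i, j, γ⟩},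
      ∑ q : {n : T // F.obj n = i}, if a.1.left = q.1 ∧ a.1.right = m.1 then x q else 0 := by
    refine (pushdownMap_apply F (constRep K T) γ x m).trans (Finset.sum_congr rfl fun a _ => ?_)
    have hl : F.obj a.1.left = i := congrArg Quiver.Total.left a.2
    rw [Finset.sum_eq_single ⟨a.1.left, hl⟩]
    · by_cases h : a.1.right = m.1
      · obtain rfl : m = ⟨a.1.right, congrArg Quiver.Total.right a.2⟩ := Subtype.ext h.symm
        rw [if_pos ⟨rfl, rfl⟩]
        exact Pi.single_eq_same _ _
      · rw [if_neg fun h' => h h'.2]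
        exact Pi.single_eq_of_ne (fun h' => h (congrArg Subtype.val h').symm) _
    · exact fun q _ hq => if_neg fun h => hq (Subtype.ext h.1.symm)
    · simp
  rw [h1, Finset.sum_comm]
  refine Finset.sum_congr rfl fun q _ => ?_
  by_cases h : Over F ⟨i, j, γ⟩ q.1 m.1
  · rw [if_pos h]
    obtain ⟨a, ha, ha', hF⟩ := h
    rw [Finset.sum_eq_single ⟨a, hF⟩, if_pos ⟨ha, ha'⟩]
    · exact fun b _ hb => if_neg fun h => hb (Subtype.ext (hT.total_eq (h.1.trans ha.symm)
        (h.2.trans ha'.symm)))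
    · simp
  · rw [if_neg h]
    exact Finset.sum_eq_zero fun a _ => if_neg fun h' => h ⟨a.1, h'.1, h'.2, a.2⟩

variable [DecidableEq T]

open Classical in
/-- The matrix of a family of endomorphisms of the fibres of `F`. -/
noncomputable def fiberMatrix
    (e : ∀ i : Q, ({n : T // F.obj n = i} → K) →ₗ[K] ({n : T // F.obj n = i} → K)) :
    Matrix T T K :=
  Matrix.of fun n m => if h : F.obj m = F.obj n then e (F.obj n) (Pi.single ⟨n, rfl⟩ 1) ⟨m, h⟩ else 0

variable {e : ∀ i : Q, ({n : T // F.obj n = i} → K) →ₗ[K] ({n : T // F.obj n = i} → K)}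

theorem fiberMatrix_apply {i : Q} (n m : {n : T // F.obj n = i}) :
    fiberMatrix e n.1 m.1 = e i (Pi.single n 1) m := by
  obtain ⟨n, rfl⟩ := n
  exact dif_pos m.2

theorem fiberMatrix_apply_of_ne {n m : T} (h : F.obj n ≠ F.obj m) : fiberMatrix e n m = 0 :=
  dif_neg h.symm

theorem fiber_apply_eq_sum {i : Q} [Fintype {n : T // F.obj n = i}]
    (x : {n : T // F.obj n = i} → K) (m : {n : T // F.obj n = i}) :
    e i x m = ∑ n : {n : T // F.obj n = i}, x n * fiberMatrix e n.1 m.1 := by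
  classical
  conv_lhs => rw [pi_eq_sum_univ' x]
  rw [map_sum, Finset.sum_apply]
  refine Finset.sum_congr rfl fun n _ => ?_
  rw [map_smul, Pi.smul_apply, smul_eq_mul, fiberMatrix_apply]

theorem isIdempotentElem_fiberMatrix [Fintype T] (he : ∀ i x, e i (e i x) = e i x) :
    IsIdempotentElem (fiberMatrix e) := by
  classical
  ext n m
  rw [Matrix.mul_apply]
  by_cases h : F.obj m = F.obj n
  · rw [sum_eq_sum_fiber (F := F) (F.obj n)]
    · have := fiber_apply_eq_sum (e := e) (e (F.obj n) (Pi.single ⟨n, rfl⟩ 1)) ⟨m, h⟩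
      rw [he] at this
      rw [fiberMatrix_apply (e := e) (i := F.obj n) ⟨n, rfl⟩ ⟨m, h⟩, this]
      exact Finset.sum_congr rfl fun k _ => by
        rw [fiberMatrix_apply (e := e) (i := F.obj n) ⟨n, rfl⟩ k]
    · intro k hk
      rw [fiberMatrix_apply_of_ne hk.symm, zero_mul]
  · rw [fiberMatrix_apply_of_ne (Ne.symm h)]
    refine Finset.sum_eq_zero fun k _ => ?_
    by_cases hk : F.obj k = F.obj n
    · rw [fiberMatrix_apply_of_ne (n := k) (hk ▸ Ne.symm h), mul_zero]
    · rw [fiberMatrix_apply_of_ne (Ne.symm hk), zero_mul]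

variable [Fintype (Quiver.Total T)]

open Classical in
theorem fiberMap_single [Fintype T] (hT : IsTree T) {i j : Q}
    (γ : i ⟶ j) (n : {n : T // F.obj n = i}) :
    fiberMap K F γ (Pi.single n 1) =
      ∑ p : {n : T // F.obj n = j}, if Over F ⟨i, j, γ⟩ n.1 p.1 then Pi.single p 1 else 0 := by
  funext m
  rw [fiberMap_apply hT, Finset.sum_apply, Finset.sum_eq_single n,
    Finset.sum_eq_single m]
  · by_cases h : Over F ⟨i, j, γ⟩ n.1 m.1 <;> simp [h]
  · intro p _ hp
    by_cases h : Over F ⟨i, j, γ⟩ n.1 p.1 <;> simp [h, hp.symm]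
  · simp
  · intro q _ hq
    simp [hq]
  · simp

theorem fiberMatrix_mem_endAlgebra [Fintype T] (hT : IsTree T)
    (he : ∀ {i j : Q} (γ : i ⟶ j) (x : {n : T // F.obj n = i} → K),
      e j (fiberMap K F γ x) = fiberMap K F γ (e i x)) :
    fiberMatrix e ∈ endAlgebra K F := by
  classical
  refine ⟨fun n m h => fiberMatrix_apply_of_ne h, ?_⟩
  rintro ⟨i, j, γ⟩
  ext n m
  rw [overMatrix_mul_apply, mul_overMatrix_apply]
  -- If `n` is not above `i` or `m` is not above `j`, both sides vanish; otherwise the entry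
  -- compares coefficients at `v_m` of the two images of `v_n`.
  by_cases hn : F.obj n = i
  · by_cases hm : F.obj m = j
    · have := congrFun (he γ (Pi.single ⟨n, hn⟩ 1)) ⟨m, hm⟩
      rw [fiberMap_single hT, fiberMap_apply hT, map_sum,
        Finset.sum_apply] at this
      rw [sum_eq_sum_fiber (F := F) j, sum_eq_sum_fiber (F := F) i]
      · convert this using 2 with p _ q _
        · by_cases h : Over F ⟨i, j, γ⟩ n p.1
          · simp only [h, if_true]
            exact fiberMatrix_apply p ⟨m, hm⟩
          · simp [h]
        · by_cases h : Over F ⟨i, j, γ⟩ q.1 m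
          · simp only [h, if_true]
            exact fiberMatrix_apply ⟨n, hn⟩ q
          · simp [h]
      · exact fun q hq => if_neg fun h => hq h.obj_left
      · exact fun p hp => if_neg fun h => hp h.obj_right
    · rw [Finset.sum_eq_zero, Finset.sum_eq_zero]
      · exact fun q _ => if_neg fun h => hm h.obj_right
      · refine fun p _ => ite_eq_right_iff.2 fun h => fiberMatrix_apply_of_ne fun h' => ?_
        exact hm (h'.symm.trans h.obj_right)
  · rw [Finset.sum_eq_zero, Finset.sum_eq_zero]
    · refine fun q _ => ite_eq_right_iff.2 fun h => fiberMatrix_apply_of_ne fun h' => ?_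
      exact hn (h'.trans h.obj_left)
    · exact fun p _ => if_neg fun h => hn h.obj_left

end Fibers

/-- A family of fibre endomorphisms whose matrix is zero vanishes. -/
theorem fiber_apply_eq_zero {T Q K : Type*} [Quiver T] [Fintype T] [DecidableEq T] [Quiver Q]
    [Field K] {F : T ⥤q Q}
    {e : ∀ i : Q, ({n : T // F.obj n = i} → K) →ₗ[K] ({n : T // F.obj n = i} → K)}
    (h : fiberMatrix e = 0) (i : Q) (x : {n : T // F.obj n = i} → K) : e i x = 0 := by
  classical
  ext m
  simp [fiber_apply_eq_sum, h]

/-- A family of fibre endomorphisms whose matrix is the identity is the identity. -/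
theorem fiber_apply_eq_self {T Q K : Type*} [Quiver T] [Fintype T] [DecidableEq T] [Quiver Q]
    [Field K] {F : T ⥤q Q}
    {e : ∀ i : Q, ({n : T // F.obj n = i} → K) →ₗ[K] ({n : T // F.obj n = i} → K)}
    (h : fiberMatrix e = 1) (i : Q) (x : {n : T // F.obj n = i} → K) : e i x = x := by
  classical
  ext m
  simp [fiber_apply_eq_sum, h, Matrix.one_apply, Subtype.coe_inj]

/-- The projection onto a direct summand along a complement commutes with the action of arrows. -/
theorem Rep.projection_map {K Q : Type*} [Field K] [Quiver Q] {M : Rep K Q} (U W : M.Sub)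
    (h : ∀ i, IsCompl (U.carrier i) (W.carrier i)) {i j : Q} (γ : i ⟶ j) (x : M.obj i) :
    (U.carrier j).projection (W.carrier j) (h j) (M.map γ x) =
      M.map γ ((U.carrier i).projection (W.carrier i) (h i) x) := by
  have hx := Submodule.projection_add_projection_eq_self (h i) x
  conv_lhs => rw [← hx]
  rw [map_add, map_add, Submodule.projection_eq_self_iff _ _ |>.2
      (U.map_mem γ _ (Submodule.projection_apply_mem (h i) x)),
    (Submodule.projection_apply_eq_zero_iff (h j)).2
      (W.map_mem γ _ (Submodule.projection_apply_mem (h i).symm x)), add_zero]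

end GTM

/-! ### Indecomposability -/

theorem theoremB {K : Type*} [Field K] (hK : ringChar K ≠ 2)
    {Q : Type*} [Quiver Q] (ρ : Set (GTM.AllPaths Q)) (hρ : GTM.IsLocallyBound K ρ)
    {T : Type*} [Quiver T] [Fintype T] [Fintype (Quiver.Total T)] (hT : GTM.IsTree T)
    (F : T ⥤q Q) (hF : GTM.IsBoundMorphism K F ρ)
    (hghost : GTM.GhostFree F F)
    (h1 : ∀ (a b : Quiver.Total T) (n₁ n₂ : T), n₁ ≠ n₂ → GTM.arr F a = GTM.arr F b →
      ((a.left = b.left ∧ a.right = n₁ ∧ b.right = n₂) ∨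
        (a.right = b.right ∧ a.left = n₁ ∧ b.left = n₂)) →
      ∀ j : ℤˣ, ¬ GTM.InGenGraphMap F F n₁ n₂ j)
    (h2 : ∀ n₁ n₂ : T, n₁ ≠ n₂ → (∃ j : ℤˣ, GTM.InGenGraphMap F F n₁ n₂ j) →
      ¬ ∃ j' : ℤˣ, GTM.InGenGraphMap F F n₂ n₁ j') :
    (GTM.genTreeModule (K := K) (ρ := ρ) F hF).toRep.Indecomposable := by
  classical
  refine ⟨?_, fun U W hUW => ?_⟩
  · obtain ⟨t⟩ := hT.isTree.connected.nonempty
    refine ⟨F.obj t, ?_⟩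
    have : Nonempty {n : T // F.obj n = F.obj t} := ⟨⟨t, rfl⟩⟩
    exact inferInstanceAs (Nontrivial ({n : T // F.obj n = F.obj t} → K))
  · let e : ∀ i : Q, ({n : T // F.obj n = i} → K) →ₗ[K] ({n : T // F.obj n = i} → K) :=
      fun i => (U.carrier i).projection (W.carrier i) (hUW i)
    have hmem : GTM.fiberMatrix e ∈ GTM.endAlgebra K F :=
      GTM.fiberMatrix_mem_endAlgebra hT fun γ x => GTM.Rep.projection_map U W hUW γ x
    have hid : IsIdempotentElem (GTM.fiberMatrix e) :=
      GTM.isIdempotentElem_fiberMatrix fun i x =>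
        LinearMap.congr_fun (Submodule.isIdempotentElem_projection (hUW i)).eq x
    rcases GTM.eq_zero_or_eq_one_of_isIdempotentElem hT hghost h1 h2 hmem hid with h | h
    · refine Or.inl fun i => (Submodule.eq_bot_iff _).2 fun x hx => ?_
      rw [← (Submodule.projection_eq_self_iff (hUW i) x).2 hx]
      exact GTM.fiber_apply_eq_zero h i x
    · refine Or.inr fun i => (Submodule.eq_bot_iff _).2 fun x hx => ?_
      rw [← (Submodule.projection_apply_eq_zero_iff (hUW i)).2 hx]
      exact (GTM.fiber_apply_eq_self h i x).symm
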